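/- Consider one bosonic mode with Fock basis $(|n\rangle)_{n\ge0}$, annihilation operator $a$, and quadratures $q=a+a^\dagger$, $p=i(a^\dagger-a)$. A state is a density operator; it is Gaussian if its Wigner function (equivalently its characteristic function) is Gaussian. For a state $\rho$ with finite second moments, $\rho^G$ denotes the Gaussian state with the same mean vector and covariance matrix. A channel is a completely positive trace-preserving linear map $\mathcal N$ on the trace-class operators; $\mathcal G$ is the set of channels that map Gaussian states to Gaussian states. Put $$\Delta(\mathcal N,\rho)=\operatorname{tr}\big[\mathcal N(\rho)\big(\log \mathcal N(\rho)^G-\log\mathcal N(\rho^G)\big)\big]\in(-\infty,+\infty],$$ which is defined when $\rho$ and $\mathcal N(\rho)$ have finite second moments. It is understood as $\operatorname{tr}[\mathcal N(\rho)\log \mathcal N(\rho)^G]-\operatorname{tr}[\mathcal N(\rho)\log\mathcal N(\rho^G)]$, with $\log 0=-\infty$ and $0\cdot\infty=0$. Let $\mathcal S_0$ be the set of states $\sum_{x\in X}p(x)|x\rangle\langle x|$, where $X\subset\mathbb C$ is finite, $X=-X$, $p$ is a probability distribution on $X$ with $p(-x)=p(x)$, and $|x\rangle$ is the coherent state of amplitude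 $x$. Let $\mathcal S_0^{\mathrm{iso}}\subset\mathcal S_0$ be the set of those states that have such a representation with $\sum_x p(x)x^2=0$ (so that the covariance matrix is a multiple of the identity). For $\mathcal S\subset\mathcal S_0$ let $\mathcal F(\mathcal S)$ be the set of channels $\mathcal N$ such that, for all $\rho\in\mathcal S$, $\Delta(\mathcal N,\rho)$ is defined and $\Delta(\mathcal N,\rho)\ge0$; put $\mathcal F_0=\mathcal F(\mathcal S_0)$. **Proposition.** 1. $\mathcal F_0\setminus\mathcal G\neq\varnothing$. 2. For every $\lambda>0$, the phase-diffusion channel $\mathcal N_\lambda(\rho)=\sum_{k\ge0}P_k\rho P_k^\dagger$, with $P_k=\sum_{n\ge0}e^{-n^2\lambda^2/2}\sqrt{(n^2\lambda^2)^k/k!}\;|n\rangle\langle n|$, belongs to $\mathcal F(\mathcal S_0^{\mathrm{iso}})\setminus\mathcal G$. It fixes every thermal state. For every $\rho\in\mathcal S_0^{\mathrm{iso}}$, the states $\mathcal N_\lambda(\rho)$ and $\rho$ have the same mean vector and the same covariance matrix, and $\Delta(\mathcal N_\lambda,\rho)=0$. -/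

import Mathlib

open scoped ComplexOrder NNReal ENNReal

noncomputable section

namespace NGChan

/-! ### The one-mode system: Fock space, number states, field operators -/

/-- The Hilbert space of one mode, in its Fock representation `ℓ²(ℕ, ℂ)`. -/
abbrev Fock : Type := lp (fun _ : ℕ => ℂ) 2

/-- Bounded operators on the one-mode Hilbert space. -/
abbrev Op : Type := Fock →L[ℂ] Fock

/-- The number state `|n⟩`. -/
def ket (n : ℕ) : Fock := lp.single 2 n (1 : ℂ)

/-- The matrix element `⟨m| T |n⟩`. -/
def entry (T : Op) (m n : ℕ) : ℂ := inner ℂ (ket m) (T (ket n))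

/-- The trace `∑ₙ ⟨n| T |n⟩` (absolutely convergent for trace-class `T`). -/
def tr (T : Op) : ℂ := ∑' n : ℕ, entry T n n

/-- Finite linear combinations of number states, the common invariant domain of all polynomials
in the field operators. -/
abbrev FinFock : Type := ℕ →₀ ℂ

/-- The inclusion of the finite linear combinations of number states into the Hilbert space. -/
def incl : FinFock →ₗ[ℂ] Fock := Finsupp.linearCombination ℂ ket

/-- Annihilation operator: `a|n⟩ = √n |n-1⟩` for `n ≥ 1`, and `a|0⟩ = 0`. -/
def annih : Module.End ℂ FinFock :=
  Finsupp.linearCombination ℂ (fun n : ℕ => Finsupp.single (n - 1) ((Real.sqrt n : ℝ) : ℂ))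

/-- Creation operator: `a†|n⟩ = √(n+1) |n+1⟩`. -/
def creat : Module.End ℂ FinFock :=
  Finsupp.linearCombination ℂ
    (fun n : ℕ => Finsupp.single (n + 1) ((Real.sqrt ((n : ℝ) + 1) : ℝ) : ℂ))

/-- The quadrature operators `r₀ = q = a + a†` and `r₁ = p = i(a† - a)`. -/
def quad : Fin 2 → Module.End ℂ FinFock :=
  ![annih + creat, Complex.I • (creat - annih)]

/-! ### States and their moments -/

/-- Density operators: positive operators of trace one. -/
def IsDensity (ρ : Op) : Prop :=
  ρ.IsPositive ∧ HasSum (fun n : ℕ => entry ρ n n) 1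

/-- The expectation `tr(ρ O)` of a polynomial `O` in the field operators. -/
def expect (ρ : Op) (O : Module.End ℂ FinFock) : ℂ :=
  ∑' n : ℕ, inner ℂ (ket n) (ρ (incl (O (Finsupp.single n 1))))

/-- The mean photon number of `ρ` is finite; equivalently `ρ` has finite second moments. -/
def HasFiniteSecondMoments (ρ : Op) : Prop :=
  Summable (fun n : ℕ => (n : ℝ) * (entry ρ n n).re)

/-- The first moments `⟨rᵢ⟩`. -/
def mean (ρ : Op) : Fin 2 → ℝ := fun i => (expect ρ (quad i)).re

/-- The centred quadrature `rᵢ - ⟨rᵢ⟩`. -/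
def centred (ρ : Op) (i : Fin 2) : Module.End ℂ FinFock := quad i - ((mean ρ i : ℝ) : ℂ) • 1

/-- The covariance matrix `Γᵢⱼ = ½ ⟨{rᵢ - ⟨rᵢ⟩, rⱼ - ⟨rⱼ⟩}⟩`. -/
def cov (ρ : Op) : Matrix (Fin 2) (Fin 2) ℝ := fun i j =>
  (1 / 2) * (expect ρ (centred ρ i * centred ρ j + centred ρ j * centred ρ i)).re

/-! ### Characteristic functions and Gaussian states -/

/-- The symplectic matrix of one mode. -/
def Omega : Matrix (Fin 2) (Fin 2) ℝ := !![0, 1; -1, 0]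

/-- The Fock matrix element `⟨n| D |m⟩` of the displacement operator
`D = exp(γ a† - γ̄ a) = e^{-|γ|²/2} e^{γ a†} e^{-γ̄ a}`. The summand `k` is the contribution in
which `e^{-γ̄ a}` lowers `|m⟩` to `|k⟩` and `e^{γ a†}` raises `|k⟩` to `|n⟩`. -/
def displacementEntry (γ : ℂ) (n m : ℕ) : ℂ :=
  ((Real.exp (-‖γ‖ ^ 2 / 2) : ℝ) : ℂ) *
    ∑ k ∈ Finset.range (min n m + 1),
      ((Real.sqrt ((n.factorial : ℝ) * (m.factorial : ℝ)) : ℝ) : ℂ) /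
          ((k.factorial : ℂ) * ((n - k).factorial : ℂ) * ((m - k).factorial : ℂ)) *
        γ ^ (n - k) * (-(starRingEnd ℂ γ)) ^ (m - k)

/-- The quantum characteristic function `χ_ρ(r) = tr[D(r) ρ]` with the Weyl operator
`D(r) = exp(i r̂ᵀ Ω r) = exp(γ a† - γ̄ a)`, where `γ = r₀ + i r₁`. -/
def charFn (ρ : Op) (r : Fin 2 → ℝ) : ℂ :=
  ∑' n : ℕ, ∑' m : ℕ, displacementEntry ((r 0 : ℂ) + (r 1 : ℂ) * Complex.I) n m * entry ρ m n

/-- The Gaussian function `exp(i dᵀΩr - ½ (Ωr)ᵀ V (Ωr))`. -/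
def gaussianCharFn (d : Fin 2 → ℝ) (V : Matrix (Fin 2) (Fin 2) ℝ) (r : Fin 2 → ℝ) : ℂ :=
  Complex.exp (Complex.I * ((dotProduct d (Omega.mulVec r) : ℝ) : ℂ)
    - (1 / 2) * ((dotProduct (Omega.mulVec r) (V.mulVec (Omega.mulVec r)) : ℝ) : ℂ))

/-- Gaussian states: density operators whose characteristic function (equivalently, whose Wigner
function, its Fourier transform) is Gaussian. -/
def IsGaussianState (ρ : Op) : Prop :=
  IsDensity ρ ∧ ∃ (d : Fin 2 → ℝ) (V : Matrix (Fin 2) (Fin 2) ℝ),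
    ∀ r : Fin 2 → ℝ, charFn ρ r = gaussianCharFn d V r

/-- `σ` is the Gaussian equivalent `ρ^G` of `ρ`: the Gaussian state with the same first and second
moments as `ρ`. (A Gaussian state is determined by these moments.) -/
def IsGaussianEquivalent (ρ σ : Op) : Prop :=
  HasFiniteSecondMoments ρ ∧ IsGaussianState σ ∧ HasFiniteSecondMoments σ ∧
    mean σ = mean ρ ∧ cov σ = cov ρ

/-! ### Quantum channels -/

/-- The trace-class operators: the linear span of the positive operators of finite trace. -/
def traceClass : Submodule ℂ Op :=
  Submodule.span ℂ {T : Op | T.IsPositive ∧ Summable (fun n : ℕ => (entry T n n).re)}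

/-- A block matrix of operators is positive as an operator on the direct sum of `k` copies of the
Hilbert space. -/
def BlockPositive {k : ℕ} (T : Fin k → Fin k → Op) : Prop :=
  ∀ ψ : Fin k → Fock, 0 ≤ ∑ i, ∑ j, inner ℂ (ψ i) (T i j (ψ j))

/-- Quantum channels: completely positive trace-preserving linear maps of the trace-class
operators. The values of `N` outside the trace class play no role. -/
structure IsChannel (N : Op → Op) : Prop where
  map_mem : ∀ T ∈ traceClass, N T ∈ traceClass
  map_add : ∀ S ∈ traceClass, ∀ T ∈ traceClass, N (S + T) = N S + N T
  map_smul : ∀ (c : ℂ), ∀ T ∈ traceClass, N (c • T) = c • N T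
  completely_positive : ∀ (k : ℕ) (T : Fin k → Fin k → Op),
    (∀ i j, T i j ∈ traceClass) → BlockPositive T → BlockPositive (fun i j => N (T i j))
  trace_preserving : ∀ T ∈ traceClass, tr (N T) = tr T

/-- The set `𝒢` of Gaussian channels: channels that map Gaussian states to Gaussian states. -/
def gaussianChannels : Set (Op → Op) :=
  {N | IsChannel N ∧ ∀ ρ : Op, IsGaussianState ρ → IsGaussianState (N ρ)}

/-! ### The functional `Δ(N, ρ)` -/

/-- The spectral projection of `B` for the eigenvalue `β` (zero if `β` is not an eigenvalue). -/
def eigenProj (B : Op) (β : ℝ) : Op :=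
  (B - (β : ℂ) • (1 : Op)).ker.starProjection

/-- `-log β`, with `-log 0 = ∞`. -/
def negLog (β : ℝ) : ℝ≥0∞ := if β ≤ 0 then ⊤ else ENNReal.ofReal (-Real.log β)

/-- `-tr[A log B]` for density operators `A` and `B`, computed from the spectral decomposition
`B = ∑ β P_β` as `∑ (-log β) tr[P_β A P_β]`, with the usual convention `0 · ∞ = 0`. -/
def negTraceLog (A B : Op) : ℝ≥0∞ :=
  ∑' β : ℝ, negLog β * ENNReal.ofReal (tr (eigenProj B β * A * eigenProj B β)).re

/-- `tr[A (log B - log C)] = tr[A log B] - tr[A log C]` as an extended real number. (In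
`Δ(N, ρ)` the operator `B` is the Gaussian equivalent of `A`, so `tr[A log B]` is finite.) -/
def traceLogDiff (A B C : Op) : EReal := ((negTraceLog A C : ℝ≥0∞) : EReal) - (negTraceLog A B : ℝ≥0∞)

/-- `Δ(N, ρ) = tr[N(ρ) (log N(ρ)^G - log N(ρ^G))]` is defined and has the value `δ`. -/
def IsDelta (N : Op → Op) (ρ : Op) (δ : EReal) : Prop :=
  ∃ σ τ : Op, IsGaussianEquivalent ρ σ ∧ IsGaussianEquivalent (N ρ) τ ∧
    δ = traceLogDiff (N ρ) τ (N σ)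

/-- The channels `N` for which `Δ(N, ρ)` is defined and nonnegative for all states `ρ ∈ S`. -/
def nonnegDelta (S : Set Op) : Set (Op → Op) :=
  {N | IsChannel N ∧ ∀ ρ ∈ S, ∃ δ : EReal, IsDelta N ρ δ ∧ 0 ≤ δ}

/-! ### Coherent states, constellations, thermal states -/

theorem coherent_memℓp (x : ℂ) :
    Memℓp (fun n : ℕ => ((Real.exp (-‖x‖ ^ 2 / 2) : ℝ) : ℂ) *
      (x ^ n / ((Real.sqrt (n.factorial : ℝ) : ℝ) : ℂ))) 2 := by
  apply memℓp_gen
  have h := (Real.summable_pow_div_factorial (‖x‖ ^ 2)).mul_left (Real.exp (-‖x‖ ^ 2 / 2) ^ 2)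
  refine h.congr fun n => ?_
  have h0 : (0 : ℝ) ≤ (n.factorial : ℝ) := by positivity
  simp only [ENNReal.toReal_ofNat, Real.rpow_ofNat, norm_mul, norm_div, norm_pow,
    Complex.norm_real, Real.norm_eq_abs, abs_of_nonneg (Real.sqrt_nonneg _),
    abs_of_pos (Real.exp_pos _)]
  rw [mul_pow, div_pow, Real.sq_sqrt h0, ← pow_mul, ← pow_mul, mul_comm 2 n]

/-- The coherent state `|x⟩ = e^{-|x|²/2} ∑ₙ xⁿ/√n! |n⟩`. -/
def coherent (x : ℂ) : Fock := ⟨_, coherent_memℓp x⟩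

/-- The mixture `∑ₓ p(x) |x⟩⟨x|` of coherent states. -/
def mixture (X : Finset ℂ) (p : ℂ → ℝ) : Op :=
  ∑ x ∈ X, ((p x : ℝ) : ℂ) • InnerProductSpace.rankOne ℂ (coherent x) (coherent x)

/-- `p` is a probability distribution on the finite alphabet `X`, symmetric around the origin. -/
def IsSymmetricConstellation (X : Finset ℂ) (p : ℂ → ℝ) : Prop :=
  (∀ x ∈ X, 0 ≤ p x) ∧ ∑ x ∈ X, p x = 1 ∧ ∀ x ∈ X, -x ∈ X ∧ p (-x) = p x

/-- The set `𝒮₀` of symmetric mixtures of coherent states. -/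
def symMixtures : Set Op :=
  {ρ | ∃ (X : Finset ℂ) (p : ℂ → ℝ), IsSymmetricConstellation X p ∧ ρ = mixture X p}

/-- The states of `𝒮₀` whose constellation has equal variances and no correlation in the two
quadratures, i.e. `𝔼[X²] = 0`; their covariance matrix is a multiple of the identity. -/
def isoSymMixtures : Set Op :=
  {ρ | ∃ (X : Finset ℂ) (p : ℂ → ℝ), IsSymmetricConstellation X p ∧
    ∑ x ∈ X, ((p x : ℝ) : ℂ) * x ^ 2 = 0 ∧ ρ = mixture X p}

theorem diag_memℓp (d : ℕ → ℂ) (hd : ∀ n, ‖d n‖ ≤ 1) (ψ : Fock) :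
    Memℓp (fun n : ℕ => d n * ψ n) 2 := by
  apply memℓp_gen
  refine Summable.of_nonneg_of_le (fun n => by positivity) (fun n => ?_)
    ((lp.memℓp ψ).summable (by norm_num))
  refine Real.rpow_le_rpow (norm_nonneg _) ?_ (by norm_num)
  rw [norm_mul]
  exact mul_le_of_le_one_left (norm_nonneg _) (hd n)

/-- The operator `∑ₙ dₙ |n⟩⟨n|` for a sequence `d` bounded by one. -/
def diagOp (d : ℕ → ℂ) (hd : ∀ n, ‖d n‖ ≤ 1) : Op :=
  LinearMap.mkContinuous
    { toFun := fun ψ => (⟨_, diag_memℓp d hd ψ⟩ : Fock)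
      map_add' := fun ψ φ => lp.ext (funext fun n => mul_add (d n) (ψ n) (φ n))
      map_smul' := fun c ψ => lp.ext (funext fun n => mul_left_comm (d n) c (ψ n)) }
    1
    (fun ψ => by
      rw [one_mul]
      refine lp.norm_le_of_forall_sum_le (by norm_num) (norm_nonneg _) fun s => ?_
      refine le_trans (Finset.sum_le_sum fun n _ => ?_)
        (lp.sum_rpow_le_norm_rpow (by norm_num) ψ s)
      refine Real.rpow_le_rpow (norm_nonneg _) ?_ (by norm_num)
      change ‖d n * ψ n‖ ≤ _
      rw [norm_mul]
      exact mul_le_of_le_one_left (norm_nonneg _) (hd n))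

theorem thermal_bound (ν : ℝ≥0) (n : ℕ) :
    ‖(((ν : ℝ) ^ n / ((ν : ℝ) + 1) ^ (n + 1) : ℝ) : ℂ)‖ ≤ 1 := by
  rw [Complex.norm_real, Real.norm_of_nonneg (by positivity), div_le_one (by positivity)]
  calc (ν : ℝ) ^ n ≤ ((ν : ℝ) + 1) ^ n := by gcongr; linarith
    _ ≤ ((ν : ℝ) + 1) ^ (n + 1) := pow_le_pow_right₀ (by simp) (Nat.le_succ n)

/-- The thermal state with mean photon number `ν`. -/
def thermal (ν : ℝ≥0) : Op := diagOp _ (thermal_bound ν)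

/-! ### The phase-diffusion channel -/

theorem kraus_bound (l : ℝ) (k n : ℕ) :
    ‖((Real.exp (-((n : ℝ) ^ 2 * l ^ 2) / 2) *
      Real.sqrt (((n : ℝ) ^ 2 * l ^ 2) ^ k / (k.factorial : ℝ)) : ℝ) : ℂ)‖ ≤ 1 := by
  have hy : (0 : ℝ) ≤ (n : ℝ) ^ 2 * l ^ 2 := by positivity
  rw [Complex.norm_real, Real.norm_of_nonneg (by positivity)]
  calc _ ≤ Real.exp (-((n : ℝ) ^ 2 * l ^ 2) / 2) * Real.sqrt (Real.exp ((n : ℝ) ^ 2 * l ^ 2)) := by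
        gcongr
        exact Real.pow_div_factorial_le_exp _ hy k
    _ = 1 := by
        rw [← Real.exp_half, ← Real.exp_add]
        simp [neg_div]

/-- The Kraus operator `P_k = ∑ₙ e^{-n²λ²/2} √((n²λ²)^k / k!) |n⟩⟨n|`. -/
def kraus (l : ℝ) (k : ℕ) : Op := diagOp _ (kraus_bound l k)

/-- The phase-diffusion channel `T ↦ ∑ₖ P_k T P_k†`; the series converges in operator norm for
every trace-class `T`. -/
def phaseDiffusion (l : ℝ) (T : Op) : Op :=
  ∑' k : ℕ, kraus l k * T * ContinuousLinearMap.adjoint (kraus l k)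

end NGChan

end

/-!
The states in question are mixtures `∫ |z⟩⟨z| dμ(z)` of coherent states. Their mean vectors and
covariance matrices are determined by `𝔼[Z]`, `𝔼[Z²]` and `𝔼[|Z|²]` for `Z ∼ μ`
(`centredMoments_coherentMixture`, `CentredMoments.cov_eq`), and their characteristic functions by
the one of `μ` (`charFn_coherentMixture`).

*Phase diffusion.* The channel multiplies `⟨m| T |n⟩` by `e^{-(m-n)²λ²/2}`, which is the average of
`e^{iθ(m-n)}` over a normal phase `θ` of variance `λ²`. Hence it fixes thermal states, and it sends
a mixture of coherent states to the mixture with randomized phases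
(`phaseDiffusion_coherentMixture`). Randomizing the phase changes none of the three moments
when `𝔼[Z] = 𝔼[Z²] = 0`, so `ρ` and its image have the same thermal Gaussian equivalent, and `Δ` is
the difference of two equal terms; these are finite since `-log` of the thermal eigenvalues grows
linearly with the photon number (`negTraceLog_thermal_ne_top`). The channel is not Gaussian: along
a line, the characteristic function of the diffused coherent state `|1⟩` is a Gaussian factor times
the one of `-2 sin θ`, a bounded and non-constant random variable, hence not a normal one
(`not_isGaussianState_phaseDiffusion`).

*A non-Gaussian channel for all symmetric mixtures.* States of `symMixtures` and centred Gaussian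
states have no coherence between `|0⟩` and `|1⟩`. The channel `coherenceChannel` measures this
coherence and prepares one of two states whose average is the thermal state of mean photon number
one. It is therefore constant on the states in question, with a Gaussian value, and `Δ` vanishes.
The Gaussian equivalent of a symmetric mixture exists because the classical second moments are
those of a complex Gaussian law (`exists_gaussianMeasure_moments`). The coherent state `|1⟩` is
sent to a proper convex combination of two thermal states, which is not Gaussian
(`not_isGaussianState_coherenceChannel`).
-/

noncomputable section

namespace NGChan

open MeasureTheory ProbabilityTheory

/-! ### Matrix elements and diagonal operators -/

theorem inner_ket (n : ℕ) (φ : Fock) : inner ℂ (ket n) φ = φ n := by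
  simp [ket, lp.inner_single_left]

theorem ket_apply (n m : ℕ) : (ket n : Fock) m = if m = n then 1 else 0 := by
  simp [ket, lp.single_apply, Pi.single_apply]

theorem hasSum_ket (φ : Fock) : HasSum (fun n => φ n • ket n) φ := by
  have h := lp.hasSum_single (p := 2) (by simp) φ
  refine h.congr_fun fun n => ?_
  rw [ket, ← lp.single_smul]
  simp

theorem entry_eq (T : Op) (m n : ℕ) : entry T m n = (T (ket n) : Fock) m := inner_ket _ _

theorem op_ext {S T : Op} (h : ∀ m n, entry S m n = entry T m n) : S = T := by
  ext1 φ
  have hk : ∀ n, S (ket n) = T (ket n) := fun n => by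
    ext m
    rw [← entry_eq, ← entry_eq, h]
  have h1 := (hasSum_ket φ).mapL S
  have h2 := (hasSum_ket φ).mapL T
  simp only [map_smul, hk] at h1 h2
  exact h1.unique h2

theorem entry_add (S T : Op) (m n : ℕ) : entry (S + T) m n = entry S m n + entry T m n := by
  simp [entry]

theorem entry_smul (c : ℂ) (T : Op) (m n : ℕ) : entry (c • T) m n = c * entry T m n := by
  simp [entry]

theorem entry_zero (m n : ℕ) : entry (0 : Op) m n = 0 := by simp [entry]

/-- Matrix elements as continuous linear functionals of the operator. -/
def entryL (m n : ℕ) : Op →L[ℂ] ℂ :=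
  (innerSL ℂ (ket m)).comp (ContinuousLinearMap.apply ℂ Fock (ket n))

theorem entryL_apply (m n : ℕ) (T : Op) : entryL m n T = entry T m n := rfl

theorem diagOp_apply (d : ℕ → ℂ) (hd : ∀ n, ‖d n‖ ≤ 1) (φ : Fock) (n : ℕ) :
    (diagOp d hd φ : Fock) n = d n * φ n := rfl

theorem diagOp_ket (d : ℕ → ℂ) (hd : ∀ n, ‖d n‖ ≤ 1) (n : ℕ) :
    diagOp d hd (ket n) = d n • ket n := by
  ext m
  rw [diagOp_apply, lp.coeFn_smul, Pi.smul_apply, ket_apply]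
  split_ifs with h <;> simp [h]

theorem entry_diagOp (d : ℕ → ℂ) (hd : ∀ n, ‖d n‖ ≤ 1) (m n : ℕ) :
    entry (diagOp d hd) m n = if m = n then d n else 0 := by
  rw [entry_eq, diagOp_ket, lp.coeFn_smul, Pi.smul_apply, ket_apply]
  simp

theorem adjoint_diagOp_ket (d : ℕ → ℂ) (hd : ∀ n, ‖d n‖ ≤ 1) (n : ℕ) :
    ContinuousLinearMap.adjoint (diagOp d hd) (ket n) = (starRingEnd ℂ) (d n) • ket n := by
  ext m
  rw [← inner_ket, ContinuousLinearMap.adjoint_inner_right, diagOp_ket, inner_smul_left,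
    inner_ket, lp.coeFn_smul, Pi.smul_apply, ket_apply]
  split_ifs with h <;> simp [h]

theorem entry_conj_diagOp (d : ℕ → ℂ) (hd : ∀ n, ‖d n‖ ≤ 1) (T : Op) (m n : ℕ) :
    entry (diagOp d hd * T * ContinuousLinearMap.adjoint (diagOp d hd)) m n =
      d m * (starRingEnd ℂ) (d n) * entry T m n := by
  rw [entry_eq, mul_apply_eq_comp, mul_apply_eq_comp, diagOp_apply,
    adjoint_diagOp_ket, map_smul, lp.coeFn_smul, Pi.smul_apply, ← entry_eq, smul_eq_mul]
  ring

theorem inner_diagOp (d : ℕ → ℂ) (hd : ∀ n, ‖d n‖ ≤ 1) (φ ψ : Fock) :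
    HasSum (fun n => d n * ((starRingEnd ℂ) (φ n) * ψ n)) (inner ℂ φ (diagOp d hd ψ)) := by
  refine (lp.hasSum_inner φ (diagOp d hd ψ)).congr_fun fun n => ?_
  rw [diagOp_apply, RCLike.inner_apply]
  ring

/-! ### Positive operators and the trace class -/

theorem inner_nonneg {T : Op} (hT : T.IsPositive) (φ : Fock) :
    0 ≤ inner ℂ φ (T φ) := hT.inner_nonneg_right φ

theorem isPositive_of_inner_nonneg {T : Op} (h : ∀ φ, 0 ≤ inner ℂ φ (T φ)) : T.IsPositive := by
  rw [ContinuousLinearMap.isPositive_iff_complex]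
  intro φ
  obtain ⟨h1, h2⟩ := Complex.le_def.1 (h φ)
  rw [← inner_conj_symm]
  refine ⟨Complex.ext (by simp) ?_, h1⟩
  rw [Complex.conj_im, ← h2]
  simp

theorem entry_nonneg {T : Op} (hT : T.IsPositive) (n : ℕ) : 0 ≤ entry T n n :=
  inner_nonneg hT (ket n)

theorem entry_re_nonneg {T : Op} (hT : T.IsPositive) (n : ℕ) :
    0 ≤ (entry T n n).re := (Complex.le_def.1 (entry_nonneg hT n)).1

theorem ofReal_entry_re {T : Op} (hT : T.IsPositive) (n : ℕ) :
    ((entry T n n).re : ℂ) = entry T n n :=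
  Complex.ext rfl (by simpa using (Complex.le_def.1 (entry_nonneg hT n)).2)

theorem isPositive_diagOp (d : ℕ → ℂ) (hd : ∀ n, ‖d n‖ ≤ 1) (h0 : ∀ n, 0 ≤ d n) :
    (diagOp d hd).IsPositive := by
  refine isPositive_of_inner_nonneg fun φ => (inner_diagOp d hd φ φ).nonneg fun n => ?_
  refine mul_nonneg (h0 n) ?_
  rw [mul_comm, Complex.mul_conj]
  exact_mod_cast Complex.normSq_nonneg _

theorem exists_eq_adjoint_mul_self {H : Type*} [NormedAddCommGroup H] [InnerProductSpace ℂ H]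
    [CompleteSpace H] {T : H →L[ℂ] H} (hT : T.IsPositive) :
    ∃ B : H →L[ℂ] H, T = ContinuousLinearMap.adjoint B * B :=
  CStarAlgebra.nonneg_iff_eq_star_mul_self.1
    ((ContinuousLinearMap.nonneg_iff_isPositive T).2 hT)

/-- The operator norm of a positive operator is bounded by its trace: if `T = B†B`, then
`∑ₙ ⟨n|T|n⟩` is the squared Hilbert–Schmidt norm of `B`. -/
theorem norm_le_trace_of_isPositive {T : Op} (hT : T.IsPositive)
    (hs : Summable fun n => (entry T n n).re) : ‖T‖ ≤ ∑' n, (entry T n n).re := by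
  obtain ⟨B, rfl⟩ := exists_eq_adjoint_mul_self hT
  have he : ∀ n, (entry (ContinuousLinearMap.adjoint B * B) n n).re = ‖B (ket n)‖ ^ 2 := fun n => by
    rw [entry, mul_apply_eq_comp,
      ContinuousLinearMap.adjoint_inner_right, inner_self_eq_norm_sq_to_K]
    norm_cast
  simp only [he] at hs ⊢
  rw [ContinuousLinearMap.mul_def, ContinuousLinearMap.norm_adjoint_comp_self, ← sq]
  have h0 : 0 ≤ ∑' n, ‖B (ket n)‖ ^ 2 := tsum_nonneg fun n => by positivity
  rw [← Real.le_sqrt (norm_nonneg _) h0]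
  refine B.opNorm_le_bound (Real.sqrt_nonneg _) fun φ => ?_
  have h1 := (hasSum_ket φ).mapL B
  refine le_of_tendsto h1.norm (Filter.Eventually.of_forall fun s => ?_)
  calc ‖∑ n ∈ s, B (φ n • ket n)‖ ≤ ∑ n ∈ s, ‖B (ket n)‖ * ‖φ n‖ := by
        refine (norm_sum_le _ _).trans (Finset.sum_le_sum fun n _ => ?_)
        rw [map_smul, norm_smul, mul_comm]
    _ ≤ Real.sqrt (∑ n ∈ s, ‖B (ket n)‖ ^ 2) * Real.sqrt (∑ n ∈ s, ‖φ n‖ ^ 2) :=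
        Real.sum_mul_le_sqrt_mul_sqrt _ _ _
    _ ≤ Real.sqrt (∑' n, ‖B (ket n)‖ ^ 2) * ‖φ‖ := by
        gcongr
        · exact hs.sum_le_tsum _ fun n _ => by positivity
        · refine Real.sqrt_le_iff.2 ⟨norm_nonneg _, ?_⟩
          have := lp.sum_rpow_le_norm_rpow (p := 2) (by norm_num) φ s
          simpa using this

theorem mem_traceClass {T : Op} (hT : T.IsPositive)
    (hs : Summable fun n => (entry T n n).re) : T ∈ traceClass :=
  Submodule.subset_span ⟨hT, hs⟩

theorem IsDensity.mem_traceClass {T : Op} (hT : IsDensity T) : T ∈ traceClass :=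
  NGChan.mem_traceClass hT.1 (Complex.hasSum_re hT.2).summable

theorem IsDensity.tr_eq {T : Op} (hT : IsDensity T) : tr T = 1 := hT.2.tsum_eq

theorem summable_entry {T : Op} (hT : T ∈ traceClass) : Summable fun n => entry T n n := by
  induction hT using Submodule.span_induction with
  | mem T h => exact (Complex.summable_ofReal.2 h.2).congr fun n => ofReal_entry_re h.1 n
  | zero => simp [entry_zero]
  | add S T _ _ h1 h2 => simpa [entry_add] using h1.add h2
  | smul c T _ h => simpa [entry_smul] using h.mul_left c

theorem tr_add {S T : Op} (hS : S ∈ traceClass) (hT : T ∈ traceClass) :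
    tr (S + T) = tr S + tr T := by
  simp only [tr, entry_add]
  exact (summable_entry hS).tsum_add (summable_entry hT)

theorem tr_smul (c : ℂ) (T : Op) : tr (c • T) = c * tr T := by
  simp only [tr, entry_smul, tsum_mul_left]

/-! ### The phase-diffusion channel -/

/-- The diagonal coefficients of the Kraus operators of the phase-diffusion channel. -/
def krausCoeff (l : ℝ) (k n : ℕ) : ℝ :=
  Real.exp (-((n : ℝ) ^ 2 * l ^ 2) / 2) *
    Real.sqrt (((n : ℝ) ^ 2 * l ^ 2) ^ k / (k.factorial : ℝ))

theorem hasSum_krausCoeff_mul (l : ℝ) (m n : ℕ) :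
    HasSum (fun k => krausCoeff l k m * krausCoeff l k n)
      (Real.exp (-(((m : ℝ) - n) ^ 2 * l ^ 2) / 2)) := by
  have h := (NormedSpace.expSeries_div_hasSum_exp ((m : ℝ) * n * l ^ 2)).mul_left
    (Real.exp (-((m : ℝ) ^ 2 * l ^ 2) / 2) * Real.exp (-((n : ℝ) ^ 2 * l ^ 2) / 2))
  rw [← Real.exp_eq_exp_ℝ, ← Real.exp_add, ← Real.exp_add] at h
  convert! h using 1
  · ext k
    have : Real.sqrt (((m : ℝ) ^ 2 * l ^ 2) ^ k / (k.factorial : ℝ)) *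
        Real.sqrt (((n : ℝ) ^ 2 * l ^ 2) ^ k / (k.factorial : ℝ)) =
        ((m : ℝ) * n * l ^ 2) ^ k / (k.factorial : ℝ) := by
      rw [← Real.sqrt_mul (by positivity), Real.sqrt_eq_iff_mul_self_eq (by positivity)
        (by positivity)]
      ring
    rw [← this, krausCoeff, krausCoeff, Real.exp_add]
    ring
  · congr 1
    ring

theorem entry_kraus_conj (l : ℝ) (k : ℕ) (T : Op) (m n : ℕ) :
    entry (kraus l k * T * ContinuousLinearMap.adjoint (kraus l k)) m n =
      ((krausCoeff l k m * krausCoeff l k n : ℝ) : ℂ) * entry T m n := by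
  rw [kraus, entry_conj_diagOp, Complex.conj_ofReal, ← Complex.ofReal_mul]
  rfl

theorem isPositive_kraus_conj (l : ℝ) (k : ℕ) {T : Op} (hT : T.IsPositive) :
    (kraus l k * T * ContinuousLinearMap.adjoint (kraus l k)).IsPositive :=
  isPositive_of_inner_nonneg fun φ => by
    rw [mul_apply_eq_comp, mul_apply_eq_comp, ← ContinuousLinearMap.adjoint_inner_left]
    exact inner_nonneg hT _

theorem summable_krausCoeff_mul_prod (l : ℝ) {t : ℕ → ℝ} (h0 : ∀ n, 0 ≤ t n)
    (ht : Summable t) :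
    Summable fun q : ℕ × ℕ => krausCoeff l q.1 q.2 * krausCoeff l q.1 q.2 * t q.2 := by
  have hone : ∀ n, HasSum (fun k => krausCoeff l k n * krausCoeff l k n) 1 := fun n => by
    simpa using hasSum_krausCoeff_mul l n n
  have h2 : Summable fun q : ℕ × ℕ => krausCoeff l q.2 q.1 * krausCoeff l q.2 q.1 * t q.1 := by
    refine (summable_prod_of_nonneg fun q => ?_).2 ⟨fun n => ?_, ?_⟩
    · exact mul_nonneg (mul_self_nonneg _) (h0 _)
    · exact (hone n).summable.mul_right (t n)
    · refine ht.congr fun n => ?_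
      change t n = ∑' k, krausCoeff l k n * krausCoeff l k n * t n
      rw [tsum_mul_right, (hone n).tsum_eq, one_mul]
  exact h2.prod_symm

/-- For a positive `T` the norms `‖P_k T P_k†‖` are bounded by the traces, which sum up to the
trace of `T`. -/
theorem summable_kraus_conj (l : ℝ) {T : Op} (hT : T ∈ traceClass) :
    Summable fun k => kraus l k * T * ContinuousLinearMap.adjoint (kraus l k) := by
  induction hT using Submodule.span_induction with
  | mem T h =>
    obtain ⟨hp, hs⟩ := h
    have hre : ∀ k n, (entry (kraus l k * T * ContinuousLinearMap.adjoint (kraus l k)) n n).re =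
        krausCoeff l k n * krausCoeff l k n * (entry T n n).re := fun k n => by
      rw [entry_kraus_conj, Complex.re_ofReal_mul]
    have h3 := summable_krausCoeff_mul_prod l (entry_re_nonneg hp) hs
    refine Summable.of_norm_bounded h3.prod fun k => ?_
    refine (norm_le_trace_of_isPositive (isPositive_kraus_conj l k hp) ?_).trans_eq ?_
    · simpa only [hre] using h3.prod_factor k
    · simp only [hre]
  | zero => simp
  | add S T _ _ h1 h2 => simpa only [mul_add, add_mul] using h1.add h2
  | smul c T _ h => simpa only [mul_smul_comm, smul_mul_assoc] using h.const_smul c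

/-- Phase diffusion multiplies the coherence `⟨m| T |n⟩` by `e^{-(m-n)²λ²/2}`. -/
theorem entry_phaseDiffusion (l : ℝ) {T : Op} (hT : T ∈ traceClass) (m n : ℕ) :
    entry (phaseDiffusion l T) m n =
      (Real.exp (-(((m : ℝ) - n) ^ 2 * l ^ 2) / 2) : ℂ) * entry T m n := by
  have h1 := (summable_kraus_conj l hT).hasSum.mapL (entryL m n)
  simp only [entryL_apply, entry_kraus_conj] at h1
  exact h1.unique ((Complex.hasSum_ofReal.2 (hasSum_krausCoeff_mul l m n)).mul_right _)

theorem entry_phaseDiffusion_self (l : ℝ) {T : Op} (hT : T ∈ traceClass) (n : ℕ) :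
    entry (phaseDiffusion l T) n n = entry T n n := by
  rw [entry_phaseDiffusion l hT]
  simp

theorem isChannel_phaseDiffusion (l : ℝ) : IsChannel (phaseDiffusion l) := by
  have hadd : ∀ S ∈ traceClass, ∀ T ∈ traceClass,
      phaseDiffusion l (S + T) = phaseDiffusion l S + phaseDiffusion l T := fun S hS T hT => by
    rw [phaseDiffusion, phaseDiffusion, phaseDiffusion,
      ← (summable_kraus_conj l hS).tsum_add (summable_kraus_conj l hT)]
    simp only [mul_add, add_mul]
  have hsmul : ∀ (c : ℂ), ∀ T ∈ traceClass, phaseDiffusion l (c • T) = c • phaseDiffusion l T :=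
    fun c T hT => by
      rw [phaseDiffusion, phaseDiffusion, ← (summable_kraus_conj l hT).tsum_const_smul]
      simp only [mul_smul_comm, smul_mul_assoc]
  refine ⟨fun T hT => ?_, hadd, hsmul, fun k T hT hpos ψ => ?_, fun T hT => ?_⟩
  · induction hT using Submodule.span_induction with
    | mem T h =>
      have hT : T ∈ traceClass := mem_traceClass h.1 h.2
      refine mem_traceClass (isPositive_of_inner_nonneg fun φ => ?_) ?_
      · exact ((summable_kraus_conj l hT).hasSum.mapL
          ((innerSL ℂ φ).comp (ContinuousLinearMap.apply ℂ Fock φ))).nonneg fun k =>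
            inner_nonneg (isPositive_kraus_conj l k h.1) φ
      · simpa only [entry_phaseDiffusion_self l hT] using h.2
    | zero => simp [phaseDiffusion]
    | add S T hS hT h1 h2 =>
      rw [hadd S hS T hT]
      exact add_mem h1 h2
    | smul c T hT h =>
      rw [hsmul c T hT]
      exact Submodule.smul_mem _ _ h
  · have h : HasSum (fun r => ∑ i, ∑ j, inner ℂ (ψ i)
        ((kraus l r * T i j * ContinuousLinearMap.adjoint (kraus l r)) (ψ j)))
        (∑ i, ∑ j, inner ℂ (ψ i) (phaseDiffusion l (T i j) (ψ j))) :=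
      hasSum_sum fun i _ => hasSum_sum fun j _ =>
        (summable_kraus_conj l (hT i j)).hasSum.mapL
          ((innerSL ℂ (ψ i)).comp (ContinuousLinearMap.apply ℂ Fock (ψ j)))
    refine h.nonneg fun r => ?_
    simp only [mul_apply_eq_comp]
    simp only [← ContinuousLinearMap.adjoint_inner_left (kraus l r)]
    exact hpos _
  · simp only [tr, entry_phaseDiffusion_self l hT]

/-! ### The functional `-tr[A log B]` for diagonal `B` -/

theorem sub_smul_one_apply (B : Op) (c : ℂ) (φ : Fock) : (B - c • (1 : Op)) φ = B φ - c • φ := rfl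

theorem eigenProj_diagOp_ket (b : ℕ → ℝ) (hb : ∀ n, ‖(b n : ℂ)‖ ≤ 1) (β : ℝ) (m : ℕ) :
    eigenProj (diagOp (fun n => (b n : ℂ)) hb) β (ket m) = if b m = β then ket m else 0 := by
  rw [eigenProj]
  split_ifs with h
  · rw [Submodule.starProjection_eq_self_iff, LinearMap.mem_ker]
    change (_ : Op) (ket m) = 0
    rw [sub_smul_one_apply, diagOp_ket, h, sub_self]
  · rw [Submodule.starProjection_apply_eq_zero_iff, Submodule.mem_orthogonal]
    intro φ hφ
    rw [LinearMap.mem_ker] at hφ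
    change (_ : Op) φ = 0 at hφ
    have h2 : ((b m : ℂ) - β) * φ m = 0 := by
      rw [sub_mul]
      exact congrArg (fun ψ : Fock => ψ m) hφ
    have h3 : φ m = 0 := (mul_eq_zero.1 h2).resolve_left
      (sub_ne_zero.2 fun h' => h (Complex.ofReal_injective h'))
    rw [← inner_conj_symm, inner_ket, h3, map_zero]

theorem entry_eigenProj_conj (A : Op) (b : ℕ → ℝ) (hb : ∀ n, ‖(b n : ℂ)‖ ≤ 1) (β : ℝ) (m : ℕ) :
    entry (eigenProj (diagOp (fun n => (b n : ℂ)) hb) β * A *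
      eigenProj (diagOp (fun n => (b n : ℂ)) hb) β) m m = if b m = β then entry A m m else 0 := by
  have h : ∀ φ ψ : Fock, inner ℂ φ (eigenProj (diagOp (fun n => (b n : ℂ)) hb) β ψ) =
      inner ℂ (eigenProj (diagOp (fun n => (b n : ℂ)) hb) β φ) ψ := fun φ ψ =>
    (Submodule.inner_starProjection_left_eq_right _ _ _).symm
  rw [entry, mul_apply_eq_comp, mul_apply_eq_comp, h, eigenProj_diagOp_ket]
  split_ifs <;> simp [entry]

/-- For diagonal `B`, the spectral formula for `-tr[A log B]` reduces to the sum over number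
states, whatever the multiplicities of the eigenvalues. -/
theorem negTraceLog_diagOp {A : Op} (hA : IsDensity A) (b : ℕ → ℝ)
    (hb : ∀ n, ‖(b n : ℂ)‖ ≤ 1) :
    negTraceLog A (diagOp (fun n => (b n : ℂ)) hb) =
      ∑' m, negLog (b m) * ENNReal.ofReal (entry A m m).re := by
  have hs : Summable fun m => (entry A m m).re := (Complex.hasSum_re hA.2).summable
  have h1 : ∀ β : ℝ, ENNReal.ofReal (tr (eigenProj (diagOp (fun n => (b n : ℂ)) hb) β * A *
      eigenProj (diagOp (fun n => (b n : ℂ)) hb) β)).re =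
      ∑' m, if b m = β then ENNReal.ofReal (entry A m m).re else 0 := fun β => by
    have hs' : Summable fun m => if b m = β then (entry A m m).re else 0 :=
      Summable.of_nonneg_of_le (fun m => by split_ifs <;> simp [entry_re_nonneg hA.1])
        (fun m => by split_ifs <;> simp [entry_re_nonneg hA.1]) hs
    have hc : tr (eigenProj (diagOp (fun n => (b n : ℂ)) hb) β * A *
        eigenProj (diagOp (fun n => (b n : ℂ)) hb) β) =
        ((∑' m, if b m = β then (entry A m m).re else 0 : ℝ) : ℂ) := by
      rw [tr, Complex.ofReal_tsum]
      refine tsum_congr fun m => ?_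
      rw [entry_eigenProj_conj]
      split_ifs
      · exact (ofReal_entry_re hA.1 m).symm
      · simp
    rw [hc, Complex.ofReal_re, ENNReal.ofReal_tsum_of_nonneg
      (fun m => by split_ifs <;> simp [entry_re_nonneg hA.1]) hs']
    refine tsum_congr fun m => ?_
    split_ifs <;> simp
  rw [negTraceLog]
  simp only [h1, ← ENNReal.tsum_mul_left]
  rw [ENNReal.tsum_comm]
  refine tsum_congr fun m => ?_
  rw [tsum_eq_single (b m) fun β hβ => by simp [hβ.symm]]
  simp

/-- The eigenvalue of the thermal state for the number state `|n⟩`. -/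
def thermalWeight (ν : ℝ≥0) (n : ℕ) : ℝ := (ν : ℝ) ^ n / ((ν : ℝ) + 1) ^ (n + 1)

theorem norm_thermalWeight_le_one (ν : ℝ≥0) (n : ℕ) : ‖(thermalWeight ν n : ℂ)‖ ≤ 1 :=
  thermal_bound ν n

theorem thermal_eq (ν : ℝ≥0) :
    thermal ν = diagOp (fun n => (thermalWeight ν n : ℂ)) (norm_thermalWeight_le_one ν) := rfl

theorem entry_thermal (ν : ℝ≥0) (m n : ℕ) :
    entry (thermal ν) m n = if m = n then (thermalWeight ν n : ℂ) else 0 :=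
  entry_diagOp _ _ m n

/-- The entropic term is finite because `-log` of the eigenvalues of a thermal state grows
linearly in the photon number. For `ν = 0` both states are the vacuum. -/
theorem negTraceLog_thermal_ne_top {A : Op} (hA : IsDensity A) {ν : ℝ≥0}
    (hν : HasSum (fun n : ℕ => (n : ℝ) * (entry A n n).re) ν) :
    negTraceLog A (thermal ν) ≠ ⊤ := by
  rw [thermal_eq, negTraceLog_diagOp hA]
  have hs : Summable fun m => (entry A m m).re := (Complex.hasSum_re hA.2).summable
  have h0 := entry_re_nonneg hA.1
  rcases eq_or_ne ν 0 with rfl | hne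
  · have hz : ∀ m, m ≠ 0 → (entry A m m).re = 0 := fun m hm => by
      have := (hasSum_zero_iff_of_nonneg fun n => mul_nonneg n.cast_nonneg (h0 n)).1
        (by simpa using hν)
      have h := congrFun this m
      simpa [hm] using h
    rw [tsum_eq_single 0 fun m hm => by simp [hz m hm]]
    have h1 : thermalWeight 0 0 = 1 := by simp [thermalWeight]
    rw [h1, negLog, if_neg one_pos.not_ge]
    exact ENNReal.mul_ne_top ENNReal.ofReal_ne_top ENNReal.ofReal_ne_top
  · have hpos : (0 : ℝ) < ν := by positivity
    set c₀ := Real.log ((ν : ℝ) + 1) with hc₀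
    set c₁ := Real.log ((ν : ℝ) + 1) - Real.log ν with hc₁
    have hlog : ∀ m, -Real.log (thermalWeight ν m) = c₀ + m * c₁ := fun m => by
      rw [thermalWeight, Real.log_div (by positivity) (by positivity), Real.log_pow, Real.log_pow]
      push_cast
      ring
    have hc₀' : 0 ≤ c₀ := Real.log_nonneg (by linarith)
    have hc₁' : 0 ≤ c₁ := sub_nonneg.2 (Real.log_le_log hpos (by linarith))
    have hsum : Summable fun m : ℕ => (c₀ + m * c₁) * (entry A m m).re :=
      ((hs.mul_left c₀).add (hν.summable.mul_left c₁)).congr fun m => by ring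
    have heq : ∀ m, negLog (thermalWeight ν m) * ENNReal.ofReal (entry A m m).re =
        ENNReal.ofReal ((c₀ + m * c₁) * (entry A m m).re) := fun m => by
      have : 0 < thermalWeight ν m := by rw [thermalWeight]; positivity
      rw [negLog, if_neg this.not_ge, hlog, ENNReal.ofReal_mul (by positivity)]
    simp only [heq]
    rw [← ENNReal.ofReal_tsum_of_nonneg (fun m => mul_nonneg (by positivity) (h0 m)) hsum]
    exact ENNReal.ofReal_ne_top

theorem traceLogDiff_thermal_self {A : Op} (hA : IsDensity A) {ν : ℝ≥0}
    (hν : HasSum (fun n : ℕ => (n : ℝ) * (entry A n n).re) ν) :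
    traceLogDiff A (thermal ν) (thermal ν) = 0 :=
  EReal.sub_self (EReal.coe_ennreal_eq_top_iff.not.2 (negTraceLog_thermal_ne_top hA hν))
    (EReal.coe_ennreal_ne_bot _)

/-! ### Thermal states -/

theorem thermal_ratio_lt_one (ν : ℝ≥0) : (ν : ℝ) / (ν + 1) < 1 := by
  rw [div_lt_one (by positivity)]
  linarith

theorem one_sub_thermal_ratio (ν : ℝ≥0) : 1 - (ν : ℝ) / (ν + 1) = 1 / (ν + 1) := by
  field_simp
  ring

theorem norm_thermal_ratio_lt_one (ν : ℝ≥0) : ‖(ν : ℝ) / (ν + 1)‖ < 1 := by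
  rw [Real.norm_of_nonneg (by positivity)]
  exact thermal_ratio_lt_one ν

theorem thermalWeight_eq (ν : ℝ≥0) (n : ℕ) :
    thermalWeight ν n = ((ν : ℝ) / (ν + 1)) ^ n * (1 / (ν + 1)) := by
  rw [thermalWeight, div_pow, pow_succ, div_mul_div_comm, mul_one]

theorem thermalWeight_nonneg (ν : ℝ≥0) (n : ℕ) : 0 ≤ thermalWeight ν n := by
  rw [thermalWeight]
  positivity

/-- The factorial moments of the geometric distribution of mean `ν`. -/
theorem hasSum_choose_mul_thermalWeight (ν : ℝ≥0) (j : ℕ) :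
    HasSum (fun n => (n.choose j : ℝ) * thermalWeight ν n) ((ν : ℝ) ^ j) := by
  -- The terms with `n < j` vanish.
  rw [← (add_left_injective j).hasSum_iff fun n hn => ?_]
  · have h := ((hasSum_choose_mul_geometric_of_norm_lt_one j
      (norm_thermal_ratio_lt_one ν)).mul_right (1 / ((ν : ℝ) + 1))).mul_left
        (((ν : ℝ) / (ν + 1)) ^ j)
    rw [one_sub_thermal_ratio] at h
    convert! h using 1
    · ext n
      simp only [Function.comp_apply, thermalWeight_eq, pow_add]
      ring
    · rw [div_pow, div_pow, one_pow, pow_succ]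
      field_simp
  · have : n < j := by
      by_contra! h
      exact hn ⟨n - j, Nat.sub_add_cancel h⟩
    simp [Nat.choose_eq_zero_of_lt this]

theorem hasSum_thermalWeight (ν : ℝ≥0) : HasSum (thermalWeight ν) 1 := by
  simpa using hasSum_choose_mul_thermalWeight ν 0

theorem hasSum_nat_mul_thermalWeight (ν : ℝ≥0) :
    HasSum (fun n : ℕ => (n : ℝ) * thermalWeight ν n) ν := by
  simpa using hasSum_choose_mul_thermalWeight ν 1

theorem isDensity_thermal (ν : ℝ≥0) : IsDensity (thermal ν) := by
  refine ⟨isPositive_diagOp _ _ fun n => ?_, ?_⟩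
  · exact Complex.zero_le_real.2 (thermalWeight_nonneg ν n)
  · simp only [entry_thermal, if_true]
    rw [← Complex.ofReal_one]
    exact Complex.hasSum_ofReal.2 (hasSum_thermalWeight ν)

theorem hasSum_nat_mul_entry_thermal (ν : ℝ≥0) :
    HasSum (fun n : ℕ => (n : ℝ) * (entry (thermal ν) n n).re) ν := by
  simpa [entry_thermal] using hasSum_nat_mul_thermalWeight ν

theorem displacementEntry_self (γ : ℂ) (n : ℕ) :
    displacementEntry γ n n = ((Real.exp (-‖γ‖ ^ 2 / 2) : ℝ) : ℂ) *
      ((∑ j ∈ Finset.range (n + 1),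
        (n.choose j : ℝ) * ((-‖γ‖ ^ 2) ^ j / j.factorial) : ℝ) : ℂ) := by
  rw [displacementEntry, min_self, ← Finset.sum_range_reflect (fun k => _) (n + 1),
    Complex.ofReal_sum]
  congr 1
  refine Finset.sum_congr rfl fun j hj => ?_
  have hj : j ≤ n := Nat.lt_succ_iff.1 (Finset.mem_range.1 hj)
  have e : n + 1 - 1 - j = n - j := by omega
  rw [e, Nat.sub_sub_self hj, Real.sqrt_mul_self (by positivity), mul_assoc, ← mul_pow, mul_neg,
    Complex.mul_conj, Complex.normSq_eq_norm_sq, Nat.cast_choose ℝ hj]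
  have h1 : (j.factorial : ℂ) ≠ 0 := by exact_mod_cast j.factorial_ne_zero
  have h2 : ((n - j).factorial : ℂ) ≠ 0 := by exact_mod_cast (n - j).factorial_ne_zero
  push_cast
  field_simp

/-- The Laguerre generating function `∑ₙ Lₙ(s) νⁿ/(ν+1)ⁿ⁺¹ = e^{-νs}`. -/
theorem hasSum_laguerre_mul_thermalWeight (ν : ℝ≥0) (s : ℝ) :
    HasSum (fun n => (∑ j ∈ Finset.range (n + 1), (n.choose j : ℝ) * ((-s) ^ j / j.factorial)) *
      thermalWeight ν n) (Real.exp (-(ν * s))) := by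
  have hfin : ∀ n, (∑ j ∈ Finset.range (n + 1), (n.choose j : ℝ) * ((-s) ^ j / j.factorial)) *
      thermalWeight ν n =
      ∑' j, (-s) ^ j / j.factorial * ((n.choose j : ℝ) * thermalWeight ν n) := fun n => by
    rw [tsum_eq_sum (s := Finset.range (n + 1)) fun j hj => ?_, Finset.sum_mul]
    · exact Finset.sum_congr rfl fun j _ => by ring
    · rw [Finset.mem_range, not_lt] at hj
      simp [Nat.choose_eq_zero_of_lt (show n < j by omega)]
  have hsum : Summable (Function.uncurry fun j n : ℕ =>
      (-s) ^ j / j.factorial * ((n.choose j : ℝ) * thermalWeight ν n)) := by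
    have hn : ∀ j n : ℕ, ‖(-s) ^ j / j.factorial * ((n.choose j : ℝ) * thermalWeight ν n)‖ =
        |s| ^ j / j.factorial * ((n.choose j : ℝ) * thermalWeight ν n) := fun j n => by
      have := thermalWeight_nonneg ν n
      rw [norm_mul, norm_div, norm_pow, norm_neg, Real.norm_eq_abs,
        Real.norm_of_nonneg (by positivity : (0 : ℝ) ≤ j.factorial),
        Real.norm_of_nonneg (by positivity)]
    refine Summable.of_norm ?_
    refine (summable_prod_of_nonneg fun q => norm_nonneg _).2 ⟨fun j => ?_, ?_⟩
    · simp only [Function.uncurry, hn]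
      exact (hasSum_choose_mul_thermalWeight ν j).summable.mul_left _
    · simp only [Function.uncurry, hn, tsum_mul_left,
        (hasSum_choose_mul_thermalWeight ν _).tsum_eq]
      refine (Real.summable_pow_div_factorial (|s| * ν)).congr fun j => ?_
      rw [mul_pow]
      ring
  simp only [hfin]
  convert! hsum.prod_symm.prod.hasSum using 1
  refine Eq.trans ?_ hsum.tsum_comm.symm
  simp only [tsum_mul_left, (hasSum_choose_mul_thermalWeight ν _).tsum_eq]
  rw [Real.exp_eq_exp_ℝ, ← (NormedSpace.expSeries_div_hasSum_exp (-((ν : ℝ) * s))).tsum_eq]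
  refine tsum_congr fun j => ?_
  rw [show -((ν : ℝ) * s) = (-s) * ν by ring, mul_pow]
  ring

theorem charFn_eq_of_diagonal {T : Op} (hT : ∀ m n, m ≠ n → entry T m n = 0) (r : Fin 2 → ℝ) :
    charFn T r =
      ∑' n, displacementEntry ((r 0 : ℂ) + (r 1 : ℂ) * Complex.I) n n * entry T n n := by
  rw [charFn]
  exact tsum_congr fun n => tsum_eq_single n fun m hm => by rw [hT m n hm, mul_zero]

theorem hasSum_displacementEntry_mul_entry_thermal (ν : ℝ≥0) (r : Fin 2 → ℝ) :
    HasSum (fun n => displacementEntry ((r 0 : ℂ) + (r 1 : ℂ) * Complex.I) n n *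
      entry (thermal ν) n n)
      (Real.exp (-((2 * ν + 1) * (r 0 ^ 2 + r 1 ^ 2) / 2) : ℝ) : ℂ) := by
  have hγ : ‖(r 0 : ℂ) + (r 1 : ℂ) * Complex.I‖ ^ 2 = r 0 ^ 2 + r 1 ^ 2 := by
    rw [← Complex.normSq_eq_norm_sq, Complex.normSq_add_mul_I]
  have h := Complex.hasSum_ofReal.2 ((hasSum_laguerre_mul_thermalWeight ν
    (r 0 ^ 2 + r 1 ^ 2)).mul_left (Real.exp (-(r 0 ^ 2 + r 1 ^ 2) / 2)))
  rw [← Real.exp_add] at h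
  convert! h using 1
  · ext n
    rw [displacementEntry_self, hγ, entry_thermal, if_pos rfl]
    push_cast
    ring
  · congr 2
    ring

theorem charFn_thermal (ν : ℝ≥0) (r : Fin 2 → ℝ) :
    charFn (thermal ν) r = (Real.exp (-((2 * ν + 1) * (r 0 ^ 2 + r 1 ^ 2) / 2) : ℝ) : ℂ) := by
  rw [charFn_eq_of_diagonal fun m n h => by rw [entry_thermal, if_neg h]]
  exact (hasSum_displacementEntry_mul_entry_thermal ν r).tsum_eq

theorem isGaussianState_thermal (ν : ℝ≥0) : IsGaussianState (thermal ν) := by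
  refine ⟨isDensity_thermal ν, 0, (2 * (ν : ℝ) + 1) • 1, fun r => ?_⟩
  rw [charFn_thermal, gaussianCharFn, Complex.ofReal_exp]
  congr 1
  simp [Omega, dotProduct, Matrix.mulVec, Matrix.smul_apply]
  ring

theorem phaseDiffusion_thermal (l : ℝ) (ν : ℝ≥0) :
    phaseDiffusion l (thermal ν) = thermal ν := by
  refine op_ext fun m n => ?_
  rw [entry_phaseDiffusion l (isDensity_thermal ν).mem_traceClass, entry_thermal]
  split_ifs with h
  · simp [h]
  · simp

/-! ### First and second moments -/

theorem incl_single (n : ℕ) (c : ℂ) : incl (Finsupp.single n c) = c • ket n := by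
  simp [incl, Finsupp.linearCombination_single]

theorem annih_single (n : ℕ) (c : ℂ) :
    annih (Finsupp.single n c) = Finsupp.single (n - 1) (c * (Real.sqrt n : ℂ)) := by
  simp [annih, Finsupp.linearCombination_single]

theorem creat_single (n : ℕ) (c : ℂ) :
    creat (Finsupp.single n c) = Finsupp.single (n + 1) (c * (Real.sqrt ((n : ℝ) + 1) : ℂ)) := by
  simp [creat, Finsupp.linearCombination_single]

/-- The series defining `tr(ρ O)` converges to `z`. -/
def HasExpect (ρ : Op) (O : Module.End ℂ FinFock) (z : ℂ) : Prop :=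
  HasSum (fun n : ℕ => inner ℂ (ket n) (ρ (incl (O (Finsupp.single n 1))))) z

theorem HasExpect.expect_eq {ρ : Op} {O : Module.End ℂ FinFock} {z : ℂ} (h : HasExpect ρ O z) :
    expect ρ O = z := h.tsum_eq

theorem HasExpect.add {ρ : Op} {O P : Module.End ℂ FinFock} {z y : ℂ} (h : HasExpect ρ O z)
    (h' : HasExpect ρ P y) : HasExpect ρ (O + P) (z + y) := by
  simpa only [HasExpect, LinearMap.add_apply, map_add, inner_add_right] using HasSum.add h h'

theorem HasExpect.smul {ρ : Op} {O : Module.End ℂ FinFock} {z : ℂ} (c : ℂ)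
    (h : HasExpect ρ O z) : HasExpect ρ (c • O) (c * z) := by
  simpa only [HasExpect, LinearMap.smul_apply, map_smul, inner_smul_right] using
    HasSum.mul_left c h

theorem HasExpect.sub {ρ : Op} {O P : Module.End ℂ FinFock} {z y : ℂ} (h : HasExpect ρ O z)
    (h' : HasExpect ρ P y) : HasExpect ρ (O - P) (z - y) := by
  simpa only [HasExpect, LinearMap.sub_apply, map_sub, inner_sub_right] using HasSum.sub h h'

theorem quad_zero_eq : quad 0 = annih + creat := rfl

theorem quad_one_eq : quad 1 = Complex.I • (creat - annih) := rfl

theorem momentum_sq {R : Type*} [Ring R] [Algebra ℂ R] (a c : R) :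
    (Complex.I • (c - a)) * (Complex.I • (c - a)) = a * c + c * a - (a * a + c * c) := by
  rw [smul_mul_assoc, mul_smul_comm, smul_smul, Complex.I_mul_I, neg_one_smul]
  noncomm_ring

theorem position_momentum_anticomm {R : Type*} [Ring R] [Algebra ℂ R] (a c : R) :
    (a + c) * (Complex.I • (c - a)) + (Complex.I • (c - a)) * (a + c) =
      Complex.I • (c * c - a * a + (c * c - a * a)) := by
  rw [smul_mul_assoc, mul_smul_comm, ← smul_add]
  congr 1
  noncomm_ring

/-- A density operator with `⟨a⟩ = 0`, `⟨a²⟩ = w` and mean photon number `ν`, expressed through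
its matrix elements in the Fock basis. -/
structure CentredMoments (ρ : Op) (w : ℂ) (ν : ℝ) : Prop where
  density : IsDensity ρ
  lower : HasSum (fun n : ℕ => (Real.sqrt ((n : ℝ) + 1) : ℂ) * entry ρ (n + 1) n) 0
  raise : HasSum (fun n : ℕ => (Real.sqrt ((n : ℝ) + 1) : ℂ) * entry ρ n (n + 1)) 0
  lower_sq : HasSum (fun n : ℕ => (Real.sqrt ((n : ℝ) + 1) : ℂ) * (Real.sqrt ((n : ℝ) + 2) : ℂ) *
    entry ρ (n + 2) n) w
  raise_sq : HasSum (fun n : ℕ => (Real.sqrt ((n : ℝ) + 1) : ℂ) * (Real.sqrt ((n : ℝ) + 2) : ℂ) *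
    entry ρ n (n + 2)) ((starRingEnd ℂ) w)
  number : HasSum (fun n : ℕ => (n : ℝ) * (entry ρ n n).re) ν

namespace CentredMoments

variable {ρ σ : Op} {w : ℂ} {ν : ℝ}

theorem hasExpect_annih (h : CentredMoments ρ w ν) : HasExpect ρ annih 0 := by
  rw [HasExpect, ← hasSum_nat_add_iff' 1]
  simp only [annih_single, incl_single, map_smul, inner_smul_right]
  simpa [entry] using h.lower

theorem hasExpect_creat (h : CentredMoments ρ w ν) : HasExpect ρ creat 0 := by
  simp only [HasExpect, creat_single, incl_single, map_smul, inner_smul_right]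
  simpa [entry] using h.raise

theorem hasExpect_annih_annih (h : CentredMoments ρ w ν) : HasExpect ρ (annih * annih) w := by
  rw [HasExpect, ← hasSum_nat_add_iff' 2]
  simp only [Finset.sum_range_succ, Finset.sum_range_zero, Module.End.mul_apply, annih_single,
    incl_single, map_smul, inner_smul_right]
  convert! h.lower_sq using 1
  · ext n
    rw [show n + 2 - 1 - 1 = n by omega, show n + 2 - 1 = n + 1 by omega, entry]
    push_cast
    ring
  · simp

theorem hasExpect_creat_creat (h : CentredMoments ρ w ν) :
    HasExpect ρ (creat * creat) ((starRingEnd ℂ) w) := by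
  simp only [HasExpect, Module.End.mul_apply, creat_single, incl_single, map_smul,
    inner_smul_right]
  convert! h.raise_sq using 1
  ext n
  rw [entry]
  push_cast
  rw [one_mul, show (n : ℝ) + 1 + 1 = n + 2 by ring]

theorem hasSum_number (h : CentredMoments ρ w ν) :
    HasSum (fun n : ℕ => (n : ℂ) * entry ρ n n) ν := by
  refine (Complex.hasSum_ofReal.2 h.number).congr_fun fun n => ?_
  rw [Complex.ofReal_mul, ofReal_entry_re h.density.1]
  simp

theorem hasExpect_creat_annih (h : CentredMoments ρ w ν) :
    HasExpect ρ (creat * annih) ν := by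
  simp only [HasExpect, Module.End.mul_apply, creat_single, annih_single, incl_single, map_smul,
    inner_smul_right]
  refine h.hasSum_number.congr_fun fun n => ?_
  rcases n with _ | n
  · simp
  · rw [Nat.add_sub_cancel, entry, one_mul, ← Complex.ofReal_mul, Nat.cast_succ,
      Real.mul_self_sqrt (by positivity)]
    push_cast
    rfl

theorem hasExpect_annih_creat (h : CentredMoments ρ w ν) :
    HasExpect ρ (annih * creat) (ν + 1) := by
  simp only [HasExpect, Module.End.mul_apply, creat_single, annih_single, incl_single, map_smul,
    inner_smul_right]
  refine (h.hasSum_number.add h.density.2).congr_fun fun n => ?_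
  rw [Nat.add_sub_cancel, entry, one_mul, ← Complex.ofReal_mul, Nat.cast_succ,
    Real.mul_self_sqrt (by positivity)]
  push_cast
  ring

theorem hasFiniteSecondMoments (h : CentredMoments ρ w ν) : HasFiniteSecondMoments ρ :=
  h.number.summable

theorem mean_eq (h : CentredMoments ρ w ν) : mean ρ = 0 := by
  have h0 : HasExpect ρ (quad 0) 0 := by
    simpa [quad] using h.hasExpect_annih.add h.hasExpect_creat
  have h1 : HasExpect ρ (quad 1) 0 := by
    simpa [quad_one_eq] using (h.hasExpect_creat.sub h.hasExpect_annih).smul Complex.I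
  ext i
  fin_cases i
  · simp [mean, h0.expect_eq]
  · simp [mean, h1.expect_eq]

theorem centred_eq (h : CentredMoments ρ w ν) (i : Fin 2) : centred ρ i = quad i := by
  rw [centred, h.mean_eq, Pi.zero_apply, Complex.ofReal_zero, zero_smul]
  exact sub_zero (quad i)

theorem cov_eq (h : CentredMoments ρ w ν) :
    cov ρ = !![2 * ν + 1 + 2 * w.re, 2 * w.im; 2 * w.im, 2 * ν + 1 - 2 * w.re] := by
  have aa := h.hasExpect_annih_annih
  have cc := h.hasExpect_creat_creat
  have ac := h.hasExpect_annih_creat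
  have ca := h.hasExpect_creat_annih
  have qq : HasExpect ρ (quad 0 * quad 0) ((ν + 1 + ν) + (w + (starRingEnd ℂ) w)) := by
    convert (ac.add ca).add (aa.add cc) using 1
    rw [quad_zero_eq]
    noncomm_ring
  have pp : HasExpect ρ (quad 1 * quad 1) ((ν + 1 + ν) - (w + (starRingEnd ℂ) w)) := by
    convert (ac.add ca).sub (aa.add cc) using 1
    exact momentum_sq annih creat
  have qp : HasExpect ρ (quad 0 * quad 1 + quad 1 * quad 0)
      (Complex.I * (((starRingEnd ℂ) w - w) + ((starRingEnd ℂ) w - w))) := by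
    convert ((cc.sub aa).add (cc.sub aa)).smul Complex.I using 1
    exact position_momentum_anticomm annih creat
  ext i j
  simp only [cov, h.centred_eq]
  fin_cases i <;> fin_cases j <;> simp only [Fin.zero_eta, Fin.mk_one, Fin.isValue]
  · rw [(qq.add qq).expect_eq]
    simp
    ring
  · rw [qp.expect_eq]
    simp
    ring
  · rw [add_comm, qp.expect_eq]
    simp
    ring
  · rw [(pp.add pp).expect_eq]
    simp
    ring

theorem isGaussianEquivalent (hρ : CentredMoments ρ w ν) (hσ : CentredMoments σ w ν)
    (hG : IsGaussianState σ) : IsGaussianEquivalent ρ σ :=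
  ⟨hρ.hasFiniteSecondMoments, hG, hσ.hasFiniteSecondMoments, by rw [hρ.mean_eq, hσ.mean_eq],
    by rw [hρ.cov_eq, hσ.cov_eq]⟩

end CentredMoments

theorem centredMoments_thermal (ν : ℝ≥0) : CentredMoments (thermal ν) 0 ν where
  density := isDensity_thermal ν
  lower := by simp [entry_thermal]
  raise := by simp [entry_thermal]
  lower_sq := by simp [entry_thermal]
  raise_sq := by simp [entry_thermal]
  number := hasSum_nat_mul_entry_thermal ν

/-! ### Coherent states and their mixtures -/

theorem coherent_apply (z : ℂ) (n : ℕ) : coherent z n =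
    ((Real.exp (-‖z‖ ^ 2 / 2) : ℝ) : ℂ) * (z ^ n / ((Real.sqrt (n.factorial : ℝ) : ℝ) : ℂ)) := rfl

theorem continuous_coherent_apply (n : ℕ) : Continuous fun z => coherent z n := by
  simp only [coherent_apply]
  fun_prop

/-- Coherent states are eigenvectors of the annihilation operator. -/
theorem sqrt_mul_coherent_succ (z : ℂ) (n : ℕ) :
    (Real.sqrt ((n : ℝ) + 1) : ℂ) * coherent z (n + 1) = z * coherent z n := by
  have h1 : (Real.sqrt ((n : ℝ) + 1) : ℂ) ≠ 0 :=
    Complex.ofReal_ne_zero.2 (Real.sqrt_pos.2 (by positivity)).ne'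
  have h2 : (Real.sqrt (n.factorial : ℝ) : ℂ) ≠ 0 :=
    Complex.ofReal_ne_zero.2 (Real.sqrt_pos.2 (by positivity)).ne'
  rw [coherent_apply, coherent_apply, Nat.factorial_succ, Nat.cast_mul, Nat.cast_succ,
    Real.sqrt_mul (by positivity), Complex.ofReal_mul]
  field_simp
  ring

theorem norm_coherent_apply_sq (z : ℂ) (n : ℕ) :
    ‖coherent z n‖ ^ 2 = Real.exp (-‖z‖ ^ 2) * ((‖z‖ ^ 2) ^ n / n.factorial) := by
  have h0 : (0 : ℝ) ≤ (n.factorial : ℝ) := by positivity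
  rw [coherent_apply, norm_mul, norm_div, norm_pow, Complex.norm_real, Complex.norm_real,
    Real.norm_of_nonneg (Real.sqrt_nonneg _), Real.norm_of_nonneg (Real.exp_pos _).le, mul_pow,
    div_pow, Real.sq_sqrt h0, ← Real.exp_nat_mul, ← pow_mul, ← pow_mul, mul_comm 2 n]
  congr 2
  push_cast
  ring

/-- The photon number of a coherent state is Poisson distributed. -/
theorem hasSum_norm_coherent_apply_sq (z : ℂ) : HasSum (fun n => ‖coherent z n‖ ^ 2) 1 := by
  have h := (NormedSpace.expSeries_div_hasSum_exp (‖z‖ ^ 2)).mul_left (Real.exp (-‖z‖ ^ 2))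
  rw [← Real.exp_eq_exp_ℝ, ← Real.exp_add, neg_add_cancel, Real.exp_zero] at h
  simpa only [norm_coherent_apply_sq] using h

theorem norm_coherent (z : ℂ) : ‖coherent z‖ = 1 := by
  have h := lp.norm_rpow_eq_tsum (p := 2) (by norm_num) (coherent z)
  have h1 : ‖coherent z‖ ^ 2 = 1 := by
    simpa [(hasSum_norm_coherent_apply_sq z).tsum_eq] using h
  exact (pow_eq_one_iff_of_nonneg (norm_nonneg _) two_ne_zero).1 h1

theorem stronglyMeasurable_coherent : StronglyMeasurable coherent :=
  stronglyMeasurable_of_tendsto Filter.atTop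
    (f := fun N z => ∑ n ∈ Finset.range N, coherent z n • ket n)
    (fun _ => (continuous_finsetSum _ fun n _ =>
      (continuous_coherent_apply n).smul continuous_const).stronglyMeasurable)
    (tendsto_pi_nhds.2 fun z => (hasSum_ket (coherent z)).tendsto_sum_nat)

/-- The projection `|z⟩⟨z|`. -/
def coherentProj (z : ℂ) : Op := InnerProductSpace.rankOne ℂ (coherent z) (coherent z)

theorem coherentProj_apply (z : ℂ) (φ : Fock) :
    coherentProj z φ = inner ℂ (coherent z) φ • coherent z := rfl

theorem inner_coherentProj (z : ℂ) (φ ψ : Fock) :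
    inner ℂ φ (coherentProj z ψ) = inner ℂ (coherent z) ψ * inner ℂ φ (coherent z) := by
  rw [coherentProj_apply, inner_smul_right]

theorem entry_coherentProj (z : ℂ) (m n : ℕ) :
    entry (coherentProj z) m n = coherent z m * (starRingEnd ℂ) (coherent z n) := by
  rw [entry, inner_coherentProj, inner_ket, ← inner_conj_symm, inner_ket, mul_comm]

theorem stronglyMeasurable_coherentProj : StronglyMeasurable coherentProj := by
  have h : Continuous fun φ : Fock => (InnerProductSpace.rankOne ℂ φ φ : Op) :=
    ((ContinuousLinearMap.smulRightL ℂ Fock Fock).continuous.comp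
      (innerSL ℂ).continuous).clm_apply continuous_id
  exact h.comp_stronglyMeasurable stronglyMeasurable_coherent

theorem norm_coherentProj (z : ℂ) : ‖coherentProj z‖ = 1 := by
  rw [coherentProj, InnerProductSpace.norm_rankOne, norm_coherent, one_mul]

theorem integrable_coherentProj (μ : Measure ℂ) [IsFiniteMeasure μ] :
    Integrable coherentProj μ :=
  Integrable.of_bound stronglyMeasurable_coherentProj.aestronglyMeasurable 1
    (Filter.Eventually.of_forall fun z => (norm_coherentProj z).le)

/-- The mixture `∫ |z⟩⟨z| dμ(z)` of coherent states. -/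
def coherentMixture (μ : Measure ℂ) : Op := ∫ z, coherentProj z ∂μ

/-- Averaging against the Poisson weights of the coherent states. -/
theorem hasSum_integral_mul_poisson (μ : Measure ℂ) {g : ℂ → ℂ} (hg : Integrable g μ) :
    HasSum (fun n => ∫ z, g z * ((‖coherent z n‖ ^ 2 : ℝ) : ℂ) ∂μ) (∫ z, g z ∂μ) := by
  have hs : ∀ z, HasSum (fun n => ‖g z‖ * ‖coherent z n‖ ^ 2) ‖g z‖ := fun z => by
    simpa using (hasSum_norm_coherent_apply_sq z).mul_left ‖g z‖
  refine hasSum_integral_of_dominated_convergence (fun n z => ‖g z‖ * ‖coherent z n‖ ^ 2)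
    (fun n => ?_) (fun n => Filter.Eventually.of_forall fun z => ?_)
    (Filter.Eventually.of_forall fun z => (hs z).summable) ?_
    (Filter.Eventually.of_forall fun z => ?_)
  · refine hg.aestronglyMeasurable.mul (Continuous.aestronglyMeasurable ?_)
    exact Complex.continuous_ofReal.comp ((continuous_coherent_apply n).norm.pow 2)
  · rw [norm_mul, Complex.norm_real, Real.norm_of_nonneg (by positivity)]
  · simpa only [(hs _).tsum_eq] using hg.norm
  · simpa using (Complex.hasSum_ofReal.2 (hasSum_norm_coherent_apply_sq z)).mul_left (g z)

section

variable (μ : Measure ℂ) [IsProbabilityMeasure μ]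

theorem entry_coherentMixture (m n : ℕ) : entry (coherentMixture μ) m n =
    ∫ z, coherent z m * (starRingEnd ℂ) (coherent z n) ∂μ := by
  rw [← entryL_apply, coherentMixture,
    ← ContinuousLinearMap.integral_comp_comm _ (integrable_coherentProj μ)]
  simp only [entryL_apply, entry_coherentProj]

theorem isPositive_coherentMixture : (coherentMixture μ).IsPositive := by
  refine isPositive_of_inner_nonneg fun φ => ?_
  have h := ContinuousLinearMap.integral_comp_comm
    ((innerSL ℂ φ).comp (ContinuousLinearMap.apply ℂ Fock φ)) (integrable_coherentProj μ)
  have h' : inner ℂ φ (coherentMixture μ φ) = ∫ z, inner ℂ φ (coherentProj z φ) ∂μ := h.symm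
  have h'' : ∀ z, inner ℂ φ (coherentProj z φ) = ((‖inner ℂ (coherent z) φ‖ ^ 2 : ℝ) : ℂ) :=
    fun z => by
      rw [inner_coherentProj, ← inner_conj_symm φ, Complex.mul_conj, Complex.normSq_eq_norm_sq]
  rw [h', integral_congr_ae (Filter.Eventually.of_forall h''), integral_complex_ofReal]
  exact Complex.zero_le_real.2 (integral_nonneg fun z => by positivity)

theorem isDensity_coherentMixture : IsDensity (coherentMixture μ) := by
  refine ⟨isPositive_coherentMixture μ, ?_⟩
  have h := hasSum_integral_mul_poisson μ (integrable_const (1 : ℂ))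
  simp only [one_mul, integral_const, probReal_univ, one_smul] at h
  refine h.congr_fun fun n => ?_
  simp only [entry_coherentMixture, Complex.mul_conj, Complex.normSq_eq_norm_sq]

theorem centredMoments_coherentMixture {w : ℂ} {ν : ℝ} (h2 : Integrable (fun z => ‖z‖ ^ 2) μ)
    (hα : ∫ z, z ∂μ = 0) (hw : ∫ z, z ^ 2 ∂μ = w) (hν : ∫ z, ‖z‖ ^ 2 ∂μ = ν) :
    CentredMoments (coherentMixture μ) w ν := by
  have i1 : Integrable (fun z : ℂ => z) μ := by
    refine (h2.add (integrable_const 1)).mono' continuous_id.aestronglyMeasurable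
      (Filter.Eventually.of_forall fun z => ?_)
    simp only [Pi.add_apply]
    nlinarith [sq_nonneg (‖z‖ - 1), norm_nonneg z]
  have i2 : Integrable (fun z : ℂ => z ^ 2) μ :=
    h2.mono' (continuous_pow 2).aestronglyMeasurable
      (Filter.Eventually.of_forall fun z => (norm_pow z 2).le)
  have i1' : Integrable (fun z : ℂ => (starRingEnd ℂ) z) μ :=
    i1.mono (Complex.continuous_conj.aestronglyMeasurable)
      (Filter.Eventually.of_forall fun z => by simp)
  have i2' : Integrable (fun z : ℂ => (starRingEnd ℂ) (z ^ 2)) μ :=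
    i2.mono ((Complex.continuous_conj.comp (continuous_pow 2)).aestronglyMeasurable)
      (Filter.Eventually.of_forall fun z => by simp)
  have i2r : Integrable (fun z : ℂ => ((‖z‖ ^ 2 : ℝ) : ℂ)) μ := h2.ofReal
  have hsq : ∀ (z : ℂ) (n : ℕ), (Real.sqrt ((n : ℝ) + 1) : ℂ) * (Real.sqrt ((n : ℝ) + 2) : ℂ) *
      coherent z (n + 2) = z ^ 2 * coherent z n := fun z n => by
    have h := sqrt_mul_coherent_succ z (n + 1)
    rw [Nat.cast_succ, show (n : ℝ) + 1 + 1 = n + 2 by ring] at h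
    rw [mul_assoc, h, mul_left_comm, sqrt_mul_coherent_succ]
    ring
  have hns : ∀ (z : ℂ) (n : ℕ), ((‖coherent z n‖ ^ 2 : ℝ) : ℂ) =
      coherent z n * (starRingEnd ℂ) (coherent z n) := fun z n => by
    rw [Complex.mul_conj, Complex.normSq_eq_norm_sq]
  refine ⟨isDensity_coherentMixture μ, ?_, ?_, ?_, ?_, ?_⟩
  · rw [← hα]
    refine (hasSum_integral_mul_poisson μ i1).congr_fun fun n => ?_
    rw [entry_coherentMixture, ← integral_const_mul]
    refine integral_congr_ae (Filter.Eventually.of_forall fun z => ?_)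
    simp only
    rw [← mul_assoc, sqrt_mul_coherent_succ, hns]
    ring
  · rw [← (starRingEnd ℂ).map_zero, ← hα, ← integral_conj]
    refine (hasSum_integral_mul_poisson μ i1').congr_fun fun n => ?_
    rw [entry_coherentMixture, ← integral_const_mul]
    refine integral_congr_ae (Filter.Eventually.of_forall fun z => ?_)
    have h := congrArg (starRingEnd ℂ) (sqrt_mul_coherent_succ z n)
    rw [map_mul, map_mul, Complex.conj_ofReal] at h
    simp only
    rw [mul_left_comm, h, hns]
    ring
  · rw [← hw]
    refine (hasSum_integral_mul_poisson μ i2).congr_fun fun n => ?_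
    rw [entry_coherentMixture, ← integral_const_mul]
    refine integral_congr_ae (Filter.Eventually.of_forall fun z => ?_)
    simp only
    rw [← mul_assoc, hsq, hns]
    ring
  · rw [← hw, ← integral_conj]
    refine (hasSum_integral_mul_poisson μ i2').congr_fun fun n => ?_
    rw [entry_coherentMixture, ← integral_const_mul]
    refine integral_congr_ae (Filter.Eventually.of_forall fun z => ?_)
    have h := congrArg (starRingEnd ℂ) (hsq z n)
    rw [map_mul, map_mul, map_mul, Complex.conj_ofReal, Complex.conj_ofReal] at h
    simp only
    rw [mul_left_comm, h, hns]
    ring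
  -- The term with `n = 0` vanishes; the other ones are shifted by `(n+1)|cₙ₊₁|² = |z|²|cₙ|²`.
  · rw [← hν, ← Complex.hasSum_ofReal, ← integral_complex_ofReal, ← hasSum_nat_add_iff' 1]
    simp only [Finset.range_one, Finset.sum_singleton, Nat.cast_zero, zero_mul, Complex.ofReal_zero,
      sub_zero]
    refine (hasSum_integral_mul_poisson μ i2r).congr_fun fun n => ?_
    rw [Complex.ofReal_mul, ofReal_entry_re (isPositive_coherentMixture μ), entry_coherentMixture,
      ← integral_const_mul]
    refine integral_congr_ae (Filter.Eventually.of_forall fun z => ?_)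
    have h := sqrt_mul_coherent_succ z n
    have h' := congrArg (starRingEnd ℂ) h
    rw [map_mul, map_mul, Complex.conj_ofReal] at h'
    have hs : (((n + 1 : ℕ) : ℝ) : ℂ) =
        (Real.sqrt ((n : ℝ) + 1) : ℂ) * (Real.sqrt ((n : ℝ) + 1) : ℂ) := by
      rw [← Complex.ofReal_mul, Real.mul_self_sqrt (by positivity)]
      push_cast
      rfl
    simp only
    rw [hs, mul_mul_mul_comm, h, h', hns, ← Complex.normSq_eq_norm_sq, ← Complex.mul_conj]
    ring

end

/-! ### Characteristic functions of mixtures of coherent states -/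

/-- Regrouping a triple series along `(k, i, j) ↦ (k + i, k + j)`. -/
theorem hasSum_sum_range_min {E : Type*} [NormedAddCommGroup E] {h : ℕ × ℕ × ℕ → E} {s : E}
    (hs : HasSum h s) :
    HasSum (fun p : ℕ × ℕ =>
      ∑ k ∈ Finset.range (min p.1 p.2 + 1), h (k, p.1 - k, p.2 - k)) s := by
  let e : (Σ p : ℕ × ℕ, Fin (min p.1 p.2 + 1)) → ℕ × ℕ × ℕ :=
    fun q => (q.2, q.1.1 - q.2, q.1.2 - q.2)
  have he : Function.Bijective e := by
    constructor
    · rintro ⟨⟨n, m⟩, k, hk⟩ ⟨⟨n', m'⟩, k', hk'⟩ h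
      simp only [e, Prod.mk.injEq] at h
      simp only at hk hk'
      obtain ⟨rfl, h1, h2⟩ := h
      obtain rfl : n = n' := by omega
      obtain rfl : m = m' := by omega
      rfl
    · rintro ⟨k, i, j⟩
      refine ⟨⟨(k + i, k + j), k, ?_⟩, ?_⟩
      · simp only
        omega
      · simp [e]
  have h1 : HasSum (h ∘ Equiv.ofBijective e he) s := (Equiv.ofBijective e he).hasSum_iff.2 hs
  refine h1.sigma fun p => ?_
  rw [Finset.sum_range (fun k => h (k, p.1 - k, p.2 - k))]
  exact hasSum_fintype _

theorem hasSum_mul_of_summable_norms {R : Type*} [NormedRing R] [CompleteSpace R] {ι κ : Type*}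
    {f : ι → R} {g : κ → R} {a b : R} (hf : HasSum f a) (hg : HasSum g b)
    (nf : Summable fun n => ‖f n‖) (ng : Summable fun n => ‖g n‖) :
    HasSum (fun q : ι × κ => f q.1 * g q.2) (a * b) :=
  hf.mul hg (summable_mul_of_summable_norm nf ng)

theorem hasSum_mul_mul_of_summable_norms {R : Type*} [NormedRing R] [CompleteSpace R]
    {f g h : ℕ → R} {a b c : R} (hf : HasSum f a) (hg : HasSum g b) (hh : HasSum h c)
    (nf : Summable fun n => ‖f n‖) (ng : Summable fun n => ‖g n‖)
    (nh : Summable fun n => ‖h n‖) :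
    HasSum (fun q : ℕ × ℕ × ℕ => f q.1 * (g q.2.1 * h q.2.2)) (a * (b * c)) :=
  hasSum_mul_of_summable_norms (g := fun q : ℕ × ℕ => g q.1 * h q.2) hf
    (hasSum_mul_of_summable_norms hg hh ng nh) nf (Summable.mul_norm ng nh)

theorem hasSum_exp_mul_exp_mul_exp {𝕜 : Type*} [RCLike 𝕜] (a b c : 𝕜) :
    HasSum (fun q : ℕ × ℕ × ℕ => a ^ q.1 / (q.1.factorial : 𝕜) *
      (b ^ q.2.1 / (q.2.1.factorial : 𝕜) * (c ^ q.2.2 / (q.2.2.factorial : 𝕜))))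
      (NormedSpace.exp a * (NormedSpace.exp b * NormedSpace.exp c)) := by
  have h := fun x : 𝕜 => NormedSpace.expSeries_div_hasSum_exp x
  have hn := fun x : 𝕜 => NormedSpace.norm_expSeries_div_summable x
  have h3 := hasSum_mul_mul_of_summable_norms (h a) (h b) (h c) (hn a) (hn b) (hn c)
  exact h3.congr_fun fun q => rfl

/-- The terms of the triple series for `⟨z| D(γ) |z⟩`. -/
def displacementTerm (γ z : ℂ) (q : ℕ × ℕ × ℕ) : ℂ :=
  ((Real.exp (-‖γ‖ ^ 2 / 2) * Real.exp (-‖z‖ ^ 2) : ℝ) : ℂ) *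
    (((‖z‖ ^ 2 : ℝ) : ℂ) ^ q.1 / (q.1.factorial : ℂ) *
      ((γ * (starRingEnd ℂ) z) ^ q.2.1 / (q.2.1.factorial : ℂ) *
        ((-(starRingEnd ℂ) γ * z) ^ q.2.2 / (q.2.2.factorial : ℂ))))

theorem hasSum_displacementTerm (γ z : ℂ) : HasSum (displacementTerm γ z)
    (Complex.exp (-((‖γ‖ : ℂ) ^ 2 / 2) + (γ * (starRingEnd ℂ) z - (starRingEnd ℂ) γ * z))) := by
  have h := (hasSum_exp_mul_exp_mul_exp ((‖z‖ ^ 2 : ℝ) : ℂ) (γ * (starRingEnd ℂ) z)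
    (-(starRingEnd ℂ) γ * z)).mul_left
      ((Real.exp (-‖γ‖ ^ 2 / 2) * Real.exp (-‖z‖ ^ 2) : ℝ) : ℂ)
  simp only [← Complex.exp_eq_exp_ℂ] at h
  convert! h using 1
  push_cast
  simp only [← Complex.exp_add]
  congr 1
  ring

theorem hasSum_norm_displacementTerm (γ z : ℂ) : HasSum (fun q => ‖displacementTerm γ z q‖)
    (Real.exp (-‖γ‖ ^ 2 / 2) * Real.exp (2 * ‖γ‖ * ‖z‖)) := by
  have h := (hasSum_exp_mul_exp_mul_exp (‖z‖ ^ 2) (‖γ‖ * ‖z‖) (‖γ‖ * ‖z‖)).mul_left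
    (Real.exp (-‖γ‖ ^ 2 / 2) * Real.exp (-‖z‖ ^ 2))
  simp only [← Real.exp_eq_exp_ℝ] at h
  convert! h using 1
  · ext q
    simp only [displacementTerm, norm_mul, norm_div, norm_pow, Complex.norm_real,
      Complex.norm_natCast, norm_neg, RCLike.norm_conj, Real.norm_of_nonneg (Real.exp_pos _).le,
      norm_norm]
  · simp only [← Real.exp_add]
    congr 1
    ring

theorem displacementEntry_mul_coherent (γ z : ℂ) (n m : ℕ) :
    displacementEntry γ n m * (coherent z m * (starRingEnd ℂ) (coherent z n)) =
      ∑ k ∈ Finset.range (min n m + 1), displacementTerm γ z (k, n - k, m - k) := by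
  rw [displacementEntry, mul_assoc, Finset.sum_mul, Finset.mul_sum]
  refine Finset.sum_congr rfl fun k hk => ?_
  have hk' := Finset.mem_range.1 hk
  obtain ⟨i, rfl⟩ : ∃ i, n = k + i := ⟨n - k, by omega⟩
  obtain ⟨j, rfl⟩ : ∃ j, m = k + j := ⟨m - k, by omega⟩
  have hn : (Real.sqrt ((k + i).factorial : ℝ) : ℂ) ≠ 0 :=
    Complex.ofReal_ne_zero.2 (Real.sqrt_pos.2 (by positivity)).ne'
  have hm : (Real.sqrt ((k + j).factorial : ℝ) : ℂ) ≠ 0 :=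
    Complex.ofReal_ne_zero.2 (Real.sqrt_pos.2 (by positivity)).ne'
  have hk0 : (k.factorial : ℂ) ≠ 0 := by exact_mod_cast k.factorial_ne_zero
  have hi0 : (i.factorial : ℂ) ≠ 0 := by exact_mod_cast i.factorial_ne_zero
  have hj0 : (j.factorial : ℂ) ≠ 0 := by exact_mod_cast j.factorial_ne_zero
  have hexp : ((Real.exp (-‖z‖ ^ 2) : ℝ) : ℂ) =
      ((Real.exp (-‖z‖ ^ 2 / 2) : ℝ) : ℂ) * ((Real.exp (-‖z‖ ^ 2 / 2) : ℝ) : ℂ) := by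
    rw [← Complex.ofReal_mul, ← Real.exp_add]
    congr 2
    ring
  have hz : ((‖z‖ ^ 2 : ℝ) : ℂ) = z * (starRingEnd ℂ) z := by
    rw [Complex.mul_conj, Complex.normSq_eq_norm_sq]
  simp only [displacementTerm, coherent_apply, Nat.add_sub_cancel_left, map_mul, map_div₀, map_pow,
    Complex.conj_ofReal]
  rw [Complex.ofReal_mul, hexp, hz, Real.sqrt_mul (by positivity), Complex.ofReal_mul]
  field_simp
  ring

/-- All exponential moments of `|z|` are finite; this dominates the triple series for
`⟨z| D(γ) |z⟩` under the integral over `z`. -/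
def HasExpMoments (μ : Measure ℂ) : Prop :=
  ∀ K : ℝ, Integrable (fun z => Real.exp (K * ‖z‖)) μ

theorem HasExpMoments.integrable_norm_sq {μ : Measure ℂ} (h : HasExpMoments μ) :
    Integrable (fun z => ‖z‖ ^ 2) μ := by
  refine ((h 1).const_mul 2).mono' (continuous_norm.pow 2).aestronglyMeasurable
    (Filter.Eventually.of_forall fun z => ?_)
  have := Real.quadratic_le_exp_of_nonneg (norm_nonneg z)
  rw [Real.norm_of_nonneg (by positivity), one_mul]
  nlinarith [norm_nonneg z]

/-- A mixture of coherent states has the characteristic function of its classical distribution,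
times the vacuum factor. -/
theorem charFn_coherentMixture (μ : Measure ℂ) [IsProbabilityMeasure μ] (hμ : HasExpMoments μ)
    (r : Fin 2 → ℝ) (γ : ℂ) (hγ : γ = (r 0 : ℂ) + (r 1 : ℂ) * Complex.I) :
    charFn (coherentMixture μ) r = Complex.exp (-((‖γ‖ : ℂ) ^ 2 / 2)) *
      ∫ z, Complex.exp (γ * (starRingEnd ℂ) z - (starRingEnd ℂ) γ * z) ∂μ := by
  rw [← integral_const_mul]
  simp only [← Complex.exp_add]
  have hb := fun z => hasSum_sum_range_min (hasSum_norm_displacementTerm γ z)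
  have key : HasSum (fun p : ℕ × ℕ => ∫ z, displacementEntry γ p.1 p.2 *
      (coherent z p.2 * (starRingEnd ℂ) (coherent z p.1)) ∂μ)
      (∫ z, Complex.exp (-((‖γ‖ : ℂ) ^ 2 / 2) +
        (γ * (starRingEnd ℂ) z - (starRingEnd ℂ) γ * z)) ∂μ) := by
    refine hasSum_integral_of_dominated_convergence
      (fun p z => ∑ k ∈ Finset.range (min p.1 p.2 + 1),
        ‖displacementTerm γ z (k, p.1 - k, p.2 - k)‖)
      (fun p => ?_) (fun p => Filter.Eventually.of_forall fun z => ?_)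
      (Filter.Eventually.of_forall fun z => (hb z).summable) ?_
      (Filter.Eventually.of_forall fun z => ?_)
    · refine Continuous.aestronglyMeasurable (continuous_const.mul ?_)
      exact (continuous_coherent_apply _).mul
        (Complex.continuous_conj.comp (continuous_coherent_apply _))
    · rw [displacementEntry_mul_coherent]
      exact norm_sum_le _ _
    -- The absolute series sums to a multiple of `e^{2|γ||z|}`.
    · simp only [(hb _).tsum_eq]
      exact (hμ (2 * ‖γ‖)).const_mul _
    · simp only [displacementEntry_mul_coherent]
      exact hasSum_sum_range_min (hasSum_displacementTerm γ z)
  rw [← key.tsum_eq, key.summable.tsum_prod, charFn]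
  refine tsum_congr fun n => tsum_congr fun m => ?_
  rw [entry_coherentMixture, integral_const_mul, hγ]

/-! ### Finite constellations -/

/-- The law of a random symbol drawn from `X` with probabilities `p`. -/
def constellationMeasure (X : Finset ℂ) (p : ℂ → ℝ) : Measure ℂ :=
  ∑ x ∈ X, ENNReal.ofReal (p x) • Measure.dirac x

theorem integrable_constellationMeasure {E : Type*} [NormedAddCommGroup E] (X : Finset ℂ)
    (p : ℂ → ℝ) (f : ℂ → E) : Integrable f (constellationMeasure X p) :=
  integrable_finsetSum_measure.2 fun _ _ =>
    (integrable_dirac (by finiteness)).smul_measure ENNReal.ofReal_ne_top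

theorem integral_constellationMeasure {E : Type*} [NormedAddCommGroup E] [NormedSpace ℝ E]
    [CompleteSpace E] {X : Finset ℂ} {p : ℂ → ℝ} (hp : ∀ x ∈ X, 0 ≤ p x) (f : ℂ → E) :
    ∫ z, f z ∂(constellationMeasure X p) = ∑ x ∈ X, p x • f x := by
  rw [constellationMeasure, integral_finsetSum_measure fun x _ =>
    (integrable_dirac (by finiteness)).smul_measure ENNReal.ofReal_ne_top]
  refine Finset.sum_congr rfl fun x hx => ?_
  rw [integral_smul_measure, integral_dirac, ENNReal.toReal_ofReal (hp x hx)]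

theorem hasExpMoments_constellationMeasure (X : Finset ℂ) (p : ℂ → ℝ) :
    HasExpMoments (constellationMeasure X p) := fun _ => integrable_constellationMeasure X p _

theorem mixture_eq {X : Finset ℂ} {p : ℂ → ℝ} (hp : ∀ x ∈ X, 0 ≤ p x) :
    mixture X p = coherentMixture (constellationMeasure X p) := by
  rw [coherentMixture, integral_constellationMeasure hp]
  rfl

/-- Symmetry of `μ` under `z ↦ -z`, tested on functions: continuous odd functions have mean
zero. -/
def IsEven (μ : Measure ℂ) : Prop :=
  ∀ f : ℂ → ℂ, Continuous f → (∀ z, f (-z) = -f z) → ∫ z, f z ∂μ = 0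

/-- Under a law that is invariant under `z ↦ -z`, the coherence between the vacuum and a single
photon vanishes. -/
theorem IsEven.entry_eq_zero {μ : Measure ℂ} [IsProbabilityMeasure μ] (h : IsEven μ) :
    entry (coherentMixture μ) 0 1 = 0 ∧ entry (coherentMixture μ) 1 0 = 0 := by
  constructor <;> rw [entry_coherentMixture] <;>
    refine h _ ((continuous_coherent_apply _).mul
      (Complex.continuous_conj.comp (continuous_coherent_apply _))) fun z => ?_ <;>
    simp [coherent_apply]

namespace IsSymmetricConstellation

variable {X : Finset ℂ} {p : ℂ → ℝ}

theorem isProbabilityMeasure (h : IsSymmetricConstellation X p) :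
    IsProbabilityMeasure (constellationMeasure X p) := ⟨by
  rw [constellationMeasure, Measure.finsetSum_apply]
  simp only [Measure.smul_apply, measure_univ, smul_eq_mul, mul_one]
  rw [← ENNReal.ofReal_sum_of_nonneg h.1, h.2.1, ENNReal.ofReal_one]⟩

theorem isEven (h : IsSymmetricConstellation X p) : IsEven (constellationMeasure X p) := by
  intro f _ hf
  rw [integral_constellationMeasure h.1]
  have h1 : ∑ x ∈ X, p x • f x = ∑ x ∈ X, -(p x • f x) := by
    refine Finset.sum_nbij' (fun x => -x) (fun x => -x) (fun x hx => (h.2.2 x hx).1)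
      (fun x hx => (h.2.2 x hx).1) (fun x _ => neg_neg x) (fun x _ => neg_neg x) fun x hx => ?_
    rw [hf, (h.2.2 x hx).2, smul_neg, neg_neg]
  rw [Finset.sum_neg_distrib] at h1
  exact self_eq_neg.1 h1

end IsSymmetricConstellation

/-! ### Gaussian mixtures of coherent states -/

/-- The law of `G₁ u + G₂ v` for independent standard normal `G₁` and `G₂`. -/
def gaussianMeasure (u v : ℂ) : Measure ℂ :=
  ((gaussianReal 0 1).prod (gaussianReal 0 1)).map fun q => (q.1 : ℂ) * u + (q.2 : ℂ) * v

section

variable (u v : ℂ)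

theorem continuous_gaussianMap : Continuous fun q : ℝ × ℝ => (q.1 : ℂ) * u + (q.2 : ℂ) * v := by
  fun_prop

instance : IsProbabilityMeasure (gaussianMeasure u v) :=
  Measure.isProbabilityMeasure_map (continuous_gaussianMap u v).aemeasurable

theorem integral_gaussianMeasure {E : Type*} [NormedAddCommGroup E] [NormedSpace ℝ E] {f : ℂ → E}
    (hf : StronglyMeasurable f) : ∫ z, f z ∂(gaussianMeasure u v) =
      ∫ q, f ((q.1 : ℂ) * u + (q.2 : ℂ) * v) ∂((gaussianReal 0 1).prod (gaussianReal 0 1)) :=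
  integral_map (continuous_gaussianMap u v).aemeasurable hf.aestronglyMeasurable

theorem hasExpMoments_gaussianMeasure : HasExpMoments (gaussianMeasure u v) := by
  intro K
  have hc : Continuous fun z : ℂ => Real.exp (K * ‖z‖) := by fun_prop
  rw [gaussianMeasure, integrable_map_measure hc.aestronglyMeasurable
    (continuous_gaussianMap u v).aemeasurable]
  have h1 : ∀ c : ℝ, Integrable (fun x : ℝ => Real.exp (c * |x|)) (gaussianReal 0 1) := fun c =>
    integrable_exp_mul_abs (X := id) (integrable_exp_mul_gaussianReal c)
      (integrable_exp_mul_gaussianReal (-c))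
  refine ((h1 (|K| * ‖u‖)).mul_prod (h1 (|K| * ‖v‖))).mono'
    (hc.comp (continuous_gaussianMap u v)).aestronglyMeasurable
    (Filter.Eventually.of_forall fun q => ?_)
  rw [Function.comp_apply, Real.norm_of_nonneg (Real.exp_pos _).le, ← Real.exp_add]
  refine Real.exp_le_exp.2 ?_
  have h2 : ‖(q.1 : ℂ) * u + (q.2 : ℂ) * v‖ ≤ |q.1| * ‖u‖ + |q.2| * ‖v‖ := by
    refine (norm_add_le _ _).trans_eq ?_
    simp [Complex.norm_real]
  calc K * ‖(q.1 : ℂ) * u + (q.2 : ℂ) * v‖ ≤ |K| * (|q.1| * ‖u‖ + |q.2| * ‖v‖) :=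
        mul_le_mul (le_abs_self K) h2 (norm_nonneg _) (abs_nonneg K)
    _ = _ := by ring

theorem isEven_gaussianMeasure : IsEven (gaussianMeasure u v) := by
  intro f hc hf
  have hneg : (gaussianReal 0 1).map (fun x => -x) = gaussianReal 0 1 := by
    rw [gaussianReal_map_neg, neg_zero]
  have hm : ((gaussianReal 0 1).prod (gaussianReal 0 1)).map (Prod.map (fun x => -x) fun x => -x) =
      (gaussianReal 0 1).prod (gaussianReal 0 1) := by
    rw [← Measure.map_prod_map _ _ measurable_neg measurable_neg, hneg]
  have h1 : ∫ z, f z ∂(gaussianMeasure u v) = -∫ z, f z ∂(gaussianMeasure u v) := by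
    rw [integral_gaussianMeasure u v hc.stronglyMeasurable, ← integral_neg]
    conv_lhs => rw [← hm]
    rw [integral_map (by fun_prop) (by
      exact (hc.comp (continuous_gaussianMap u v)).aestronglyMeasurable)]
    refine integral_congr_ae (Filter.Eventually.of_forall fun q => ?_)
    simp only [Prod.map_fst, Prod.map_snd]
    rw [← hf]
    congr 1
    push_cast
    ring
  exact self_eq_neg.1 h1

theorem integral_sq_gaussianReal : ∫ x, x ^ 2 ∂(gaussianReal 0 1) = 1 := by
  have h := variance_id_gaussianReal (μ := 0) (v := 1)
  rw [variance_of_integral_eq_zero (by fun_prop) (by simp)] at h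
  simpa using h

theorem integrable_sq_gaussianReal : Integrable (fun x : ℝ => x ^ 2) (gaussianReal 0 1) := by
  simpa using (memLp_id_gaussianReal 2 (μ := 0) (v := 1)).integrable_sq

theorem integrable_id_gaussianReal : Integrable (fun x : ℝ => x) (gaussianReal 0 1) := by
  exact (memLp_id_gaussianReal 1 (μ := 0) (v := 1)).integrable le_rfl

/-- Integrals of binary quadratic forms of two independent standard normal variables. -/
theorem integral_quadratic_gaussianReal (a b c : ℂ) :
    ∫ q : ℝ × ℝ, ((q.1 : ℂ) ^ 2 * a + (q.1 : ℂ) * (q.2 : ℂ) * b + (q.2 : ℂ) ^ 2 * c)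
      ∂((gaussianReal 0 1).prod (gaussianReal 0 1)) = a + c := by
  have i2 : Integrable (fun x : ℝ => (x : ℂ) ^ 2) (gaussianReal 0 1) := by
    simpa using integrable_sq_gaussianReal.ofReal (𝕜 := ℂ)
  have i1 : Integrable (fun x : ℝ => (x : ℂ)) (gaussianReal 0 1) :=
    integrable_id_gaussianReal.ofReal (𝕜 := ℂ)
  have v2 : ∫ x : ℝ, (x : ℂ) ^ 2 ∂(gaussianReal 0 1) = 1 := by
    have h := integral_complex_ofReal (f := fun x : ℝ => x ^ 2) (μ := gaussianReal 0 1)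
    rw [integral_sq_gaussianReal] at h
    simpa using h
  have v1 : ∫ x : ℝ, (x : ℂ) ∂(gaussianReal 0 1) = 0 := by
    rw [integral_complex_ofReal, integral_id_gaussianReal, Complex.ofReal_zero]
  have j1 : Integrable (fun q : ℝ × ℝ => (q.1 : ℂ) ^ 2 * a)
      ((gaussianReal 0 1).prod (gaussianReal 0 1)) := (i2.comp_fst _).mul_const a
  have j2 : Integrable (fun q : ℝ × ℝ => (q.1 : ℂ) * (q.2 : ℂ) * b)
      ((gaussianReal 0 1).prod (gaussianReal 0 1)) := (i1.mul_prod i1).mul_const b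
  have j3 : Integrable (fun q : ℝ × ℝ => (q.2 : ℂ) ^ 2 * c)
      ((gaussianReal 0 1).prod (gaussianReal 0 1)) := (i2.comp_snd _).mul_const c
  rw [integral_add (by exact j1.add j2) j3, integral_add j1 j2, integral_mul_const,
    integral_mul_const, integral_mul_const,
    integral_prod_mul (fun x : ℝ => (x : ℂ)) (fun x : ℝ => (x : ℂ)), v1,
    integral_fun_fst (fun x : ℝ => (x : ℂ) ^ 2), integral_fun_snd (fun x : ℝ => (x : ℂ) ^ 2), v2]
  simp

theorem integral_id_gaussianMeasure : ∫ z, z ∂(gaussianMeasure u v) = 0 :=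
  isEven_gaussianMeasure u v _ continuous_id fun _ => rfl

theorem integral_sq_gaussianMeasure : ∫ z, z ^ 2 ∂(gaussianMeasure u v) = u ^ 2 + v ^ 2 := by
  rw [integral_gaussianMeasure u v (continuous_pow 2).stronglyMeasurable,
    ← integral_quadratic_gaussianReal _ (2 * u * v)]
  refine integral_congr_ae (Filter.Eventually.of_forall fun q => ?_)
  ring

theorem integral_norm_sq_gaussianMeasure :
    ∫ z, ‖z‖ ^ 2 ∂(gaussianMeasure u v) = ‖u‖ ^ 2 + ‖v‖ ^ 2 := by
  have h : ((∫ z, ‖z‖ ^ 2 ∂(gaussianMeasure u v) : ℝ) : ℂ) =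
      u * (starRingEnd ℂ) u + v * (starRingEnd ℂ) v := by
    have hc : Continuous fun z : ℂ => ((‖z‖ ^ 2 : ℝ) : ℂ) := by fun_prop
    rw [← integral_complex_ofReal, integral_gaussianMeasure u v hc.stronglyMeasurable,
      ← integral_quadratic_gaussianReal _ (u * (starRingEnd ℂ) v + v * (starRingEnd ℂ) u)]
    refine integral_congr_ae (Filter.Eventually.of_forall fun q => ?_)
    simp only
    rw [← Complex.normSq_eq_norm_sq, ← Complex.mul_conj]
    simp only [map_add, map_mul, Complex.conj_ofReal]
    ring
  rw [Complex.mul_conj, Complex.mul_conj, Complex.normSq_eq_norm_sq, Complex.normSq_eq_norm_sq]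
    at h
  exact_mod_cast h

theorem integral_cexp_gaussianMeasure (γ : ℂ) :
    ∫ z, Complex.exp (γ * (starRingEnd ℂ) z - (starRingEnd ℂ) γ * z) ∂(gaussianMeasure u v) =
      Complex.exp
        (-(2 * ((γ * (starRingEnd ℂ) u).im ^ 2 + (γ * (starRingEnd ℂ) v).im ^ 2) : ℝ)) := by
  have hsub : ∀ w : ℂ, γ * (starRingEnd ℂ) w - (starRingEnd ℂ) γ * w =
      ((2 * (γ * (starRingEnd ℂ) w).im : ℝ) : ℂ) * Complex.I := fun w => by
    have h := Complex.sub_conj (γ * (starRingEnd ℂ) w)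
    rwa [map_mul, Complex.conj_conj] at h
  have hcont : Continuous fun z : ℂ =>
      Complex.exp (γ * (starRingEnd ℂ) z - (starRingEnd ℂ) γ * z) := by fun_prop
  rw [integral_gaussianMeasure u v hcont.stronglyMeasurable]
  have h1 : ∀ q : ℝ × ℝ, Complex.exp (γ * (starRingEnd ℂ) ((q.1 : ℂ) * u + (q.2 : ℂ) * v) -
      (starRingEnd ℂ) γ * ((q.1 : ℂ) * u + (q.2 : ℂ) * v)) =
      Complex.exp (((2 * (γ * (starRingEnd ℂ) u).im : ℝ) : ℂ) * (q.1 : ℂ) * Complex.I) *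
      Complex.exp (((2 * (γ * (starRingEnd ℂ) v).im : ℝ) : ℂ) * (q.2 : ℂ) * Complex.I) :=
    fun q => by
    rw [← Complex.exp_add]
    congr 1
    simp only [map_add, map_mul, Complex.conj_ofReal]
    linear_combination (q.1 : ℂ) * hsub u + (q.2 : ℂ) * hsub v
  simp only [h1]
  rw [integral_prod_mul (fun x : ℝ =>
      Complex.exp (((2 * (γ * (starRingEnd ℂ) u).im : ℝ) : ℂ) * (x : ℂ) * Complex.I))
      (fun x : ℝ =>
      Complex.exp (((2 * (γ * (starRingEnd ℂ) v).im : ℝ) : ℂ) * (x : ℂ) * Complex.I)),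
    ← charFun_apply_real, ← charFun_apply_real, charFun_gaussianReal, charFun_gaussianReal,
    ← Complex.exp_add]
  congr 1
  push_cast
  ring

theorem isGaussianState_gaussianMixture :
    IsGaussianState (coherentMixture (gaussianMeasure u v)) := by
  refine ⟨isDensity_coherentMixture _, 0, !![1 + 4 * (u.re ^ 2 + v.re ^ 2),
    4 * (u.re * u.im + v.re * v.im); 4 * (u.re * u.im + v.re * v.im),
    1 + 4 * (u.im ^ 2 + v.im ^ 2)], fun r => ?_⟩
  rw [charFn_coherentMixture _ (hasExpMoments_gaussianMeasure u v) r _ rfl,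
    integral_cexp_gaussianMeasure, ← Complex.exp_add, gaussianCharFn]
  have hγ : ((‖(r 0 : ℂ) + (r 1 : ℂ) * Complex.I‖ : ℝ) : ℂ) ^ 2 =
      ((r 0 ^ 2 + r 1 ^ 2 : ℝ) : ℂ) := by
    rw [← Complex.ofReal_pow, ← Complex.normSq_eq_norm_sq, Complex.normSq_add_mul_I]
  rw [hγ]
  congr 1
  simp [Omega, dotProduct, Matrix.mulVec, Fin.sum_univ_two]
  ring

end

/-- The second moments `w = 𝔼[Z²]` and `ν = 𝔼[|Z|²]` of a complex random variable are those of a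
complex Gaussian: if `w = ζ²|w|` with `|ζ| = 1`, take independent real Gaussians of variances
`(ν ± |w|)/2` along `ζ` and `iζ`. -/
theorem exists_gaussianMeasure_moments {w : ℂ} {ν : ℝ} (h : ‖w‖ ≤ ν) :
    ∃ u v : ℂ, u ^ 2 + v ^ 2 = w ∧ ‖u‖ ^ 2 + ‖v‖ ^ 2 = ν := by
  set ζ : ℂ := Complex.exp ((w.arg / 2 : ℝ) * Complex.I) with hζ
  have hn : ‖ζ‖ = 1 := Complex.norm_exp_ofReal_mul_I _
  have hw : (‖w‖ : ℂ) * ζ ^ 2 = w := by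
    rw [hζ, ← Complex.exp_nat_mul]
    convert Complex.norm_mul_exp_arg_mul_I w using 3
    push_cast
    ring
  have h1 : 0 ≤ (ν + ‖w‖) / 2 := by linarith [norm_nonneg w]
  have h2 : 0 ≤ (ν - ‖w‖) / 2 := by linarith
  refine ⟨(Real.sqrt ((ν + ‖w‖) / 2) : ℂ) * ζ,
    (Real.sqrt ((ν - ‖w‖) / 2) : ℂ) * (Complex.I * ζ), ?_, ?_⟩
  · rw [mul_pow, mul_pow, mul_pow, Complex.I_sq, ← Complex.ofReal_pow, ← Complex.ofReal_pow,
      Real.sq_sqrt h1, Real.sq_sqrt h2]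
    push_cast
    linear_combination hw
  · rw [norm_mul, norm_mul, norm_mul, hn, Complex.norm_I, Complex.norm_real, Complex.norm_real,
      Real.norm_of_nonneg (Real.sqrt_nonneg _), Real.norm_of_nonneg (Real.sqrt_nonneg _), mul_one,
      mul_one, mul_one, Real.sq_sqrt h1, Real.sq_sqrt h2]
    ring

/-! ### Phase diffusion of mixtures of coherent states -/

/-- The law of a phase that is normally distributed with standard deviation `l`. -/
def phaseNoise (l : ℝ) : Measure ℝ := gaussianReal 0 (Real.toNNReal (l ^ 2))

instance (l : ℝ) : IsProbabilityMeasure (phaseNoise l) := by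
  rw [phaseNoise]
  infer_instance

theorem integral_cexp_phaseNoise (l t : ℝ) :
    ∫ θ : ℝ, Complex.exp ((t : ℂ) * θ * Complex.I) ∂(phaseNoise l) =
      (Real.exp (-(t ^ 2 * l ^ 2) / 2) : ℂ) := by
  rw [phaseNoise, ← charFun_apply_real, charFun_gaussianReal, Real.coe_toNNReal _ (sq_nonneg l)]
  push_cast
  congr 1
  ring

/-- The law of `z e^{iθ}` for independent `z ∼ μ` and a normally distributed phase `θ`. -/
def diffusedMeasure (l : ℝ) (μ : Measure ℂ) : Measure ℂ :=
  (μ.prod (phaseNoise l)).map fun q => q.1 * Complex.exp ((q.2 : ℂ) * Complex.I)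

theorem continuous_rotate :
    Continuous fun q : ℂ × ℝ => q.1 * Complex.exp ((q.2 : ℂ) * Complex.I) := by
  fun_prop

theorem integrable_norm_sq_diffusedMeasure (l : ℝ) (μ : Measure ℂ)
    [SFinite μ] (h2 : Integrable (fun z => ‖z‖ ^ 2) μ) :
    Integrable (fun z => ‖z‖ ^ 2) (diffusedMeasure l μ) := by
  have hc : Continuous fun z : ℂ => ‖z‖ ^ 2 := by fun_prop
  rw [diffusedMeasure, integrable_map_measure hc.aestronglyMeasurable
    continuous_rotate.aemeasurable]
  refine (h2.comp_fst (phaseNoise l)).congr (Filter.Eventually.of_forall fun q => ?_)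
  simp [Complex.norm_exp_ofReal_mul_I]

section

variable (l : ℝ) (μ : Measure ℂ) [IsProbabilityMeasure μ]

instance : IsProbabilityMeasure (diffusedMeasure l μ) :=
  Measure.isProbabilityMeasure_map continuous_rotate.aemeasurable

/-- Integration against a phase-diffused law of a function on which a rotation by `θ` acts as the
character `e^{itθ}`. -/
theorem integral_diffusedMeasure {f : ℂ → ℂ} (hf : Continuous f) {t : ℝ}
    (hrot : ∀ (z : ℂ) (θ : ℝ), f (z * Complex.exp ((θ : ℂ) * Complex.I)) =
      f z * Complex.exp ((t : ℂ) * θ * Complex.I)) :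
    ∫ z, f z ∂(diffusedMeasure l μ) =
      (∫ z, f z ∂μ) * (Real.exp (-(t ^ 2 * l ^ 2) / 2) : ℂ) := by
  rw [diffusedMeasure, integral_map continuous_rotate.aemeasurable hf.aestronglyMeasurable]
  simp only [hrot]
  rw [integral_prod_mul f fun θ : ℝ => Complex.exp ((t : ℂ) * θ * Complex.I),
    integral_cexp_phaseNoise]

theorem coherent_rotate (z : ℂ) (θ : ℝ) (n : ℕ) :
    coherent (z * Complex.exp ((θ : ℂ) * Complex.I)) n =
      coherent z n * Complex.exp ((n : ℂ) * θ * Complex.I) := by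
  rw [coherent_apply, coherent_apply, norm_mul, Complex.norm_exp_ofReal_mul_I, mul_one, mul_pow,
    ← Complex.exp_nat_mul, ← mul_assoc (n : ℂ)]
  ring

/-- Phase diffusion of a mixture of coherent states is again such a mixture, with randomized
phases. -/
theorem phaseDiffusion_coherentMixture :
    phaseDiffusion l (coherentMixture μ) = coherentMixture (diffusedMeasure l μ) := by
  refine op_ext fun m n => ?_
  have hc : Continuous fun z => coherent z m * (starRingEnd ℂ) (coherent z n) :=
    (continuous_coherent_apply m).mul
      (Complex.continuous_conj.comp (continuous_coherent_apply n))
  rw [entry_phaseDiffusion l (isDensity_coherentMixture μ).mem_traceClass, entry_coherentMixture,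
    entry_coherentMixture, integral_diffusedMeasure l μ hc (t := (m : ℝ) - n) fun z θ => ?_,
    mul_comm]
  rw [coherent_rotate, coherent_rotate, map_mul, ← Complex.exp_conj, mul_mul_mul_comm,
    ← Complex.exp_add]
  congr 2
  simp only [map_mul, Complex.conj_ofReal, Complex.conj_I, map_natCast]
  push_cast
  ring

/-- Randomizing the phase changes neither the vanishing moments `𝔼[Z]` and `𝔼[Z²]` nor
`𝔼[|Z|²]`. -/
theorem centredMoments_phaseDiffusion {ν : ℝ} (h2 : Integrable (fun z => ‖z‖ ^ 2) μ)
    (hα : ∫ z, z ∂μ = 0) (hw : ∫ z, z ^ 2 ∂μ = 0) (hν : ∫ z, ‖z‖ ^ 2 ∂μ = ν) :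
    CentredMoments (phaseDiffusion l (coherentMixture μ)) 0 ν := by
  rw [phaseDiffusion_coherentMixture]
  refine centredMoments_coherentMixture _ (integrable_norm_sq_diffusedMeasure l μ h2) ?_ ?_ ?_
  · rw [integral_diffusedMeasure l μ continuous_id' (t := 1) fun z θ => by simp, hα, zero_mul]
  · rw [integral_diffusedMeasure l μ (continuous_pow 2) (t := 2) fun z θ => ?_, hw, zero_mul]
    rw [mul_pow, ← Complex.exp_nat_mul]
    congr 2
    push_cast
    ring
  · have h : ((∫ z, ‖z‖ ^ 2 ∂(diffusedMeasure l μ) : ℝ) : ℂ) = ν := by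
      rw [← integral_complex_ofReal, integral_diffusedMeasure l μ (by fun_prop) (t := 0)
        fun z θ => by simp [Complex.norm_exp_ofReal_mul_I], integral_complex_ofReal, hν]
      simp
    exact_mod_cast h

end

/-! ### Phase diffusion on the isotropic constellations -/

/-- The properties of a state of `isoSymMixtures` and of its image under phase diffusion that
enter the comparison with the thermal state. -/
theorem exists_centredMoments_of_mem_isoSymMixtures {ρ : Op} (hρ : ρ ∈ isoSymMixtures) (l : ℝ) :
    ∃ ν : ℝ≥0, CentredMoments ρ 0 ν ∧ CentredMoments (phaseDiffusion l ρ) 0 ν := by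
  obtain ⟨X, p, hX, hw, rfl⟩ := hρ
  have := hX.isProbabilityMeasure
  set μ := constellationMeasure X p with hμ
  have h2 := (hasExpMoments_constellationMeasure X p).integrable_norm_sq
  have hα : ∫ z, z ∂μ = 0 := hX.isEven _ continuous_id fun _ => rfl
  have hw' : ∫ z, z ^ 2 ∂μ = 0 := by
    rw [integral_constellationMeasure hX.1, ← hw]
    exact Finset.sum_congr rfl fun x _ => Complex.real_smul
  have h0 : 0 ≤ ∫ z, ‖z‖ ^ 2 ∂μ := integral_nonneg fun z => by positivity
  rw [mixture_eq hX.1]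
  exact ⟨⟨_, h0⟩, centredMoments_coherentMixture μ h2 hα hw' rfl,
    centredMoments_phaseDiffusion l μ h2 hα hw' rfl⟩

theorem isDelta_phaseDiffusion {ρ : Op} (hρ : ρ ∈ isoSymMixtures) (l : ℝ) :
    IsDelta (phaseDiffusion l) ρ 0 := by
  obtain ⟨ν, h1, h2⟩ := exists_centredMoments_of_mem_isoSymMixtures hρ l
  refine ⟨thermal ν, thermal ν,
    h1.isGaussianEquivalent (centredMoments_thermal ν) (isGaussianState_thermal ν),
    h2.isGaussianEquivalent (centredMoments_thermal ν) (isGaussianState_thermal ν), ?_⟩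
  rw [phaseDiffusion_thermal, traceLogDiff_thermal_self h2.density h2.number]

/-! ### Phase diffusion is not Gaussian -/

theorem hasExpMoments_dirac (x : ℂ) : HasExpMoments (Measure.dirac x) := fun _ =>
  integrable_dirac (by finiteness)

theorem isGaussianState_coherent (x : ℂ) :
    IsGaussianState (coherentMixture (Measure.dirac x)) := by
  refine ⟨isDensity_coherentMixture _, ![2 * x.re, 2 * x.im], 1, fun r => ?_⟩
  rw [charFn_coherentMixture _ (hasExpMoments_dirac x) r _ rfl, integral_dirac,
    ← Complex.exp_add, gaussianCharFn]
  have hγ : ((‖(r 0 : ℂ) + (r 1 : ℂ) * Complex.I‖ : ℝ) : ℂ) ^ 2 =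
      ((r 0 ^ 2 + r 1 ^ 2 : ℝ) : ℂ) := by
    rw [← Complex.ofReal_pow, ← Complex.normSq_eq_norm_sq, Complex.normSq_add_mul_I]
  rw [hγ]
  congr 1
  apply Complex.ext
  · simp [Omega, dotProduct, Matrix.mulVec, Fin.sum_univ_two, sq]
    ring
  · simp [Omega, dotProduct, Matrix.mulVec, Fin.sum_univ_two, sq]
    ring

/-- The law of `-2 sin θ` for a non-degenerate normal `θ` is not normal: it has bounded support,
so that its variance would have to vanish, but `sin θ` is not almost surely constant. -/
theorem map_sin_phaseNoise_ne_gaussianReal {l : ℝ} (hl : 0 < l) (b : ℝ) (v : ℝ≥0) :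
    (phaseNoise l).map (fun θ => -2 * Real.sin θ) ≠ gaussianReal b v := by
  intro h
  have hm : Measurable fun θ : ℝ => -2 * Real.sin θ := by fun_prop
  rcases eq_or_ne v 0 with rfl | hv
  · rw [gaussianReal_zero_var] at h
    have h1 : ∀ᵐ y ∂((phaseNoise l).map fun θ => -2 * Real.sin θ), y = b := by
      rw [h, ae_dirac_eq]
      rfl
    have h2 : ∀ᵐ θ ∂(phaseNoise l), -2 * Real.sin θ = b := ae_of_ae_map hm.aemeasurable h1
    have hl2 : Real.toNNReal (l ^ 2) ≠ 0 := by
      rw [ne_eq, Real.toNNReal_eq_zero, not_le]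
      positivity
    have h3 : ∀ᵐ θ ∂(volume : Measure ℝ), -2 * Real.sin θ = b :=
      (gaussianReal_absolutelyContinuous' 0 hl2).ae_le h2
    have h4 : (fun θ => -2 * Real.sin θ) = fun _ => b :=
      (Continuous.ae_eq_iff_eq volume (by fun_prop) continuous_const).1 h3
    have h5 := congrFun h4 0
    have h6 := congrFun h4 (Real.pi / 2)
    simp only [Real.sin_zero, Real.sin_pi_div_two] at h5 h6
    linarith
  · have h1 : gaussianReal b v (Set.Ioi 2) = 0 := by
      rw [← h, Measure.map_apply hm measurableSet_Ioi]
      convert measure_empty (μ := phaseNoise l)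
      ext θ
      simp only [Set.mem_preimage, Set.mem_Ioi, Set.mem_empty_iff_false, iff_false, not_lt]
      linarith [Real.neg_one_le_sin θ]
    have h2 := gaussianReal_absolutelyContinuous' b hv h1
    simp [Real.volume_Ioi] at h2

/-- Along the real axis, the characteristic function of the phase-diffused coherent state `|1⟩` is,
up to the vacuum factor, the one of the bounded random variable `-2 sin θ`. -/
theorem not_isGaussianState_phaseDiffusion {l : ℝ} (hl : 0 < l) :
    ¬ IsGaussianState (phaseDiffusion l (coherentMixture (Measure.dirac 1))) := by
  rintro ⟨-, d, V, hG⟩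
  set η := (phaseNoise l).map fun θ => -2 * Real.sin θ with hη
  have hm : Measurable fun θ : ℝ => -2 * Real.sin θ := by fun_prop
  have : IsProbabilityMeasure η := Measure.isProbabilityMeasure_map hm.aemeasurable
  have hexp : HasExpMoments (diffusedMeasure l (Measure.dirac 1)) := fun K => by
    have hc : Continuous fun z : ℂ => Real.exp (K * ‖z‖) := by fun_prop
    rw [diffusedMeasure, integrable_map_measure hc.aestronglyMeasurable
      continuous_rotate.aemeasurable]
    refine ((hasExpMoments_dirac 1 K).comp_fst (phaseNoise l)).congr
      (Filter.Eventually.of_forall fun q => ?_)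
    simp [Complex.norm_exp_ofReal_mul_I]
  have hchar : ∀ t : ℝ, charFun η t =
      Complex.exp ((t : ℂ) * ((-d 1 : ℝ) : ℂ) * Complex.I - ((V 1 1 - 1 : ℝ) : ℂ) * t ^ 2 / 2) :=
    fun t => by
      have h1 := hG ![t, 0]
      have hcont : Continuous fun z : ℂ =>
        Complex.exp ((t : ℂ) * (starRingEnd ℂ) z - (starRingEnd ℂ) (t : ℂ) * z) := by fun_prop
      have h2 : ∫ z, Complex.exp ((t : ℂ) * (starRingEnd ℂ) z - (starRingEnd ℂ) (t : ℂ) * z)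
          ∂(diffusedMeasure l (Measure.dirac 1)) = charFun η t := by
        rw [diffusedMeasure, Measure.dirac_prod, Measure.map_map continuous_rotate.measurable
          (by fun_prop), integral_map (by fun_prop) hcont.aestronglyMeasurable,
          charFun_apply_real, hη, integral_map hm.aemeasurable (by
            exact Continuous.aestronglyMeasurable (by fun_prop))]
        refine integral_congr_ae (Filter.Eventually.of_forall fun θ => ?_)
        simp only [Function.comp_apply, one_mul]
        congr 1
        have h := Complex.sub_conj (Complex.exp ((θ : ℂ) * Complex.I))
        rw [Complex.exp_ofReal_mul_I_im] at h
        rw [Complex.conj_ofReal]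
        push_cast at h ⊢
        linear_combination -(t : ℂ) * h
      rw [phaseDiffusion_coherentMixture, charFn_coherentMixture _ hexp _ (t : ℂ) (by simp), h2,
        gaussianCharFn] at h1
      have h3 := congrArg (Complex.exp ((‖(t : ℂ)‖ : ℂ) ^ 2 / 2) * ·) h1
      rw [← mul_assoc, ← Complex.exp_add, add_neg_cancel, Complex.exp_zero, one_mul,
        ← Complex.exp_add] at h3
      rw [h3]
      congr 1
      have hn : ((‖(t : ℂ)‖ : ℝ) : ℂ) ^ 2 = (t : ℂ) ^ 2 := by
        rw [Complex.norm_real, Real.norm_eq_abs, ← Complex.ofReal_pow, sq_abs, Complex.ofReal_pow]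
      rw [hn]
      simp [Omega, dotProduct, Matrix.mulVec, Fin.sum_univ_two]
      ring
  -- The modulus of a characteristic function is at most one.
  have hv : 0 ≤ V 1 1 - 1 := by
    have h1 := norm_charFun_le_one (μ := η) 1
    rw [hchar, Complex.norm_exp, Real.exp_le_one_iff] at h1
    simp at h1
    linarith
  refine map_sin_phaseNoise_ne_gaussianReal hl (-d 1) (Real.toNNReal (V 1 1 - 1))
    (Measure.ext_of_charFun ?_)
  ext t
  rw [← hη, hchar, charFun_gaussianReal, Real.coe_toNNReal _ hv]

/-! ### A non-Gaussian channel that is constant on even states -/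

/-- A linear functional on the trace class that is nonnegative on positive operators. -/
structure IsPositiveFunctional (f : Op → ℂ) : Prop where
  add : ∀ S ∈ traceClass, ∀ T ∈ traceClass, f (S + T) = f S + f T
  smul : ∀ (c : ℂ), ∀ T ∈ traceClass, f (c • T) = c * f T
  nonneg : ∀ T ∈ traceClass, T.IsPositive → 0 ≤ f T

namespace IsPositiveFunctional

variable {f : Op → ℂ}

theorem sum (hf : IsPositiveFunctional f) {ι : Type*} (s : Finset ι) (T : ι → Op)
    (hT : ∀ i ∈ s, T i ∈ traceClass) : f (∑ i ∈ s, T i) = ∑ i ∈ s, f (T i) := by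
  classical
  induction s using Finset.induction_on with
  | empty =>
    have := hf.smul 0 0 (zero_mem _)
    simpa using this
  | insert i s hi ih =>
    rw [Finset.sum_insert hi, Finset.sum_insert hi, hf.add _ (hT i (Finset.mem_insert_self i s)) _
      (sum_mem fun j hj => hT j (Finset.mem_insert_of_mem hj)),
      ih fun j hj => hT j (Finset.mem_insert_of_mem hj)]

/-- A positive functional is completely positive, in the form that compresses the blocks of a
positive block operator by scalars. -/
theorem sum_sum_nonneg (hf : IsPositiveFunctional f) {k : ℕ} {T : Fin k → Fin k → Op}
    (hT : ∀ i j, T i j ∈ traceClass) (hpos : BlockPositive T) (b : Fin k → ℂ) :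
    0 ≤ ∑ i, ∑ j, (starRingEnd ℂ) (b i) * b j * f (T i j) := by
  have h1 : f (∑ i, ∑ j, ((starRingEnd ℂ) (b i) * b j) • T i j) =
      ∑ i, ∑ j, (starRingEnd ℂ) (b i) * b j * f (T i j) := by
    rw [hf.sum _ _ fun i _ => sum_mem fun j _ => Submodule.smul_mem _ _ (hT i j)]
    refine Finset.sum_congr rfl fun i _ => ?_
    rw [hf.sum _ _ fun j _ => Submodule.smul_mem _ _ (hT i j)]
    exact Finset.sum_congr rfl fun j _ => hf.smul _ _ (hT i j)
  rw [← h1]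
  refine hf.nonneg _ (sum_mem fun i _ => sum_mem fun j _ => Submodule.smul_mem _ _ (hT i j))
    (isPositive_of_inner_nonneg fun φ => ?_)
  have h2 := hpos fun i => b i • φ
  simp only [map_smul, inner_smul_left, inner_smul_right] at h2
  simp only [sum_apply, smul_apply, inner_sum,
    inner_smul_right]
  refine h2.trans_eq (Finset.sum_congr rfl fun i _ => Finset.sum_congr rfl fun j _ => ?_)
  ring

/-- The measure-and-prepare map `T ↦ f(T) D` with a positive diagonal `D` is completely
positive. -/
theorem blockPositive_smul (hf : IsPositiveFunctional f) {k : ℕ} {T : Fin k → Fin k → Op}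
    (hT : ∀ i j, T i j ∈ traceClass) (hpos : BlockPositive T) {D : Op} {d : ℕ → ℝ}
    (hd : ∀ n, 0 ≤ d n) (hD : ∀ φ ψ : Fock,
      HasSum (fun n => (d n : ℂ) * ((starRingEnd ℂ) (φ n) * ψ n)) (inner ℂ φ (D ψ))) :
    BlockPositive fun i j => f (T i j) • D := by
  intro ψ
  have h : HasSum (fun n => ∑ i, ∑ j, f (T i j) *
      ((d n : ℂ) * ((starRingEnd ℂ) (ψ i n) * ψ j n)))
      (∑ i, ∑ j, inner ℂ (ψ i) ((f (T i j) • D) (ψ j))) := by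
    refine hasSum_sum fun i _ => hasSum_sum fun j _ => ?_
    rw [smul_apply, inner_smul_right]
    exact (hD (ψ i) (ψ j)).mul_left _
  refine h.nonneg fun n => ?_
  have h2 := mul_nonneg (Complex.zero_le_real.2 (hd n))
    (hf.sum_sum_nonneg hT hpos fun i => ψ i n)
  rw [Finset.mul_sum] at h2
  convert h2 using 2 with i
  rw [Finset.mul_sum]
  refine Finset.sum_congr rfl fun j _ => ?_
  ring

end IsPositiveFunctional

/-- The coherence `tr[T (|0⟩⟨1| + |1⟩⟨0|)]` between the vacuum and a single photon. -/
def coherence (T : Op) : ℂ := entry T 0 1 + entry T 1 0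

/-- The probabilities `tr[T (1 ± |0⟩⟨1| ± |1⟩⟨0|)]/2` of the two outcomes of a measurement,
where `s` is the sign. -/
def outcome (s : ℂ) (T : Op) : ℂ := (tr T + s * coherence T) / 2

theorem isPositiveFunctional_outcome {s : ℂ} (hs : s = 1 ∨ s = -1) :
    IsPositiveFunctional (outcome s) where
  add S hS T hT := by
    rw [outcome, outcome, outcome, tr_add hS hT, coherence, coherence, coherence, entry_add,
      entry_add]
    ring
  smul c T _ := by
    rw [outcome, outcome, tr_smul, coherence, coherence, entry_smul, entry_smul]
    ring
  nonneg T hT hp := by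
    have hs' : (starRingEnd ℂ) s = s ∧ s * s = 1 := by rcases hs with rfl | rfl <;> simp
    have h1 := inner_nonneg hp (ket 0 + s • ket 1)
    have h2 : inner ℂ (ket 0 + s • ket 1) (T (ket 0 + s • ket 1)) =
        entry T 0 0 + entry T 1 1 + s * coherence T := by
      rw [map_add, map_smul]
      simp only [inner_add_left, inner_add_right, inner_smul_left, inner_smul_right, hs'.1,
        coherence, entry]
      linear_combination inner ℂ (ket 1) (T (ket 1)) * hs'.2
    have h3 := (summable_entry hT).sum_add_tsum_nat_add 2
    have h4 : 0 ≤ ∑' n, entry T (n + 2) (n + 2) := tsum_nonneg fun n => entry_nonneg hp _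
    have h5 : outcome s T = (1 / 2 : ℝ) * (inner ℂ (ket 0 + s • ket 1) (T (ket 0 + s • ket 1)) +
        ∑' n, entry T (n + 2) (n + 2)) := by
      rw [h2, outcome, tr, ← h3, Finset.sum_range_succ, Finset.sum_range_one]
      push_cast
      ring
    rw [h5]
    exact mul_nonneg (Complex.zero_le_real.2 (by norm_num)) (add_nonneg h1 h4)

/-- A channel that measures the coherence between `|0⟩` and `|1⟩`, and prepares the vacuum on one
outcome and `∑_{n ≥ 1} 2⁻ⁿ |n⟩⟨n|` on the other; with equal probabilities the two outputs
average to the thermal state of mean photon number one. -/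
def coherenceChannel (T : Op) : Op :=
  outcome 1 T • thermal 0 + outcome (-1) T • ((2 : ℂ) • thermal 1 - thermal 0)

theorem coherenceChannel_eq (T : Op) : coherenceChannel T =
    coherence T • thermal 0 + (tr T - coherence T) • thermal 1 := by
  rw [coherenceChannel, outcome, outcome]
  module

theorem inner_thermal (ν : ℝ≥0) (φ ψ : Fock) :
    HasSum (fun n => (thermalWeight ν n : ℂ) * ((starRingEnd ℂ) (φ n) * ψ n))
      (inner ℂ φ (thermal ν ψ)) := inner_diagOp _ _ φ ψ

theorem thermalWeight_zero_le (n : ℕ) : 0 ≤ 2 * thermalWeight 1 n - thermalWeight 0 n := by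
  rcases n with _ | n
  · simp [thermalWeight]
    norm_num
  · have := thermalWeight_nonneg 1 (n + 1)
    have h : thermalWeight 0 (n + 1) = 0 := by simp [thermalWeight]
    linarith

theorem isChannel_coherenceChannel : IsChannel coherenceChannel := by
  have h0 := (isDensity_thermal 0).mem_traceClass
  have h1 := (isDensity_thermal 1).mem_traceClass
  have hp := isPositiveFunctional_outcome (s := 1) (Or.inl rfl)
  have hm := isPositiveFunctional_outcome (s := -1) (Or.inr rfl)
  refine ⟨fun T _ => ?_, fun S hS T hT => ?_, fun c T hT => ?_, fun k T hT hpos => ?_,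
    fun T _ => ?_⟩
  · rw [coherenceChannel_eq]
    exact add_mem (Submodule.smul_mem _ _ h0) (Submodule.smul_mem _ _ h1)
  · simp only [coherenceChannel, hp.add S hS T hT, hm.add S hS T hT]
    module
  · simp only [coherenceChannel, hp.smul c T hT, hm.smul c T hT]
    module
  · have b1 := hp.blockPositive_smul hT hpos (D := thermal 0) (thermalWeight_nonneg 0)
      (inner_thermal 0)
    have b2 := hm.blockPositive_smul hT hpos (D := (2 : ℂ) • thermal 1 - thermal 0)
      (d := fun n => 2 * thermalWeight 1 n - thermalWeight 0 n) thermalWeight_zero_le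
      fun φ ψ => by
        rw [sub_apply, smul_apply, inner_sub_right,
          inner_smul_right]
        refine (((inner_thermal 1 φ ψ).mul_left 2).sub (inner_thermal 0 φ ψ)).congr_fun
          fun n => ?_
        push_cast
        ring
    intro ψ
    have h := add_nonneg (b1 ψ) (b2 ψ)
    simp only [← Finset.sum_add_distrib, ← inner_add_right, ← add_apply] at h
    exact h
  · rw [coherenceChannel_eq, tr_add (Submodule.smul_mem _ _ h0) (Submodule.smul_mem _ _ h1),
      tr_smul, tr_smul, (isDensity_thermal 0).tr_eq, (isDensity_thermal 1).tr_eq]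
    ring

theorem coherenceChannel_of_isEven {μ : Measure ℂ} [IsProbabilityMeasure μ] (h : IsEven μ) :
    coherenceChannel (coherentMixture μ) = thermal 1 := by
  rw [coherenceChannel_eq, coherence, h.entry_eq_zero.1, h.entry_eq_zero.2,
    (isDensity_coherentMixture μ).tr_eq]
  simp

theorem isDelta_coherenceChannel {ρ : Op} (hρ : ρ ∈ symMixtures) :
    IsDelta coherenceChannel ρ 0 := by
  obtain ⟨X, p, hX, rfl⟩ := hρ
  have := hX.isProbabilityMeasure
  set μ := constellationMeasure X p with hμ
  have hν : ‖∫ z, z ^ 2 ∂μ‖ ≤ ∫ z, ‖z‖ ^ 2 ∂μ := by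
    refine (norm_integral_le_integral_norm _).trans_eq ?_
    simp only [norm_pow]
  obtain ⟨u, v, hw, hn⟩ := exists_gaussianMeasure_moments hν
  have m1 : CentredMoments (coherentMixture μ) (∫ z, z ^ 2 ∂μ) (∫ z, ‖z‖ ^ 2 ∂μ) :=
    centredMoments_coherentMixture μ (hasExpMoments_constellationMeasure X p).integrable_norm_sq
      (hX.isEven _ continuous_id fun _ => rfl) rfl rfl
  have m2 : CentredMoments (coherentMixture (gaussianMeasure u v)) (∫ z, z ^ 2 ∂μ)
      (∫ z, ‖z‖ ^ 2 ∂μ) :=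
    centredMoments_coherentMixture _ (hasExpMoments_gaussianMeasure u v).integrable_norm_sq
      (integral_id_gaussianMeasure u v) (by rw [integral_sq_gaussianMeasure, hw])
      (by rw [integral_norm_sq_gaussianMeasure, hn])
  rw [mixture_eq hX.1]
  refine ⟨_, thermal 1, m1.isGaussianEquivalent m2 (isGaussianState_gaussianMixture u v), ?_, ?_⟩
  · rw [coherenceChannel_of_isEven hX.isEven]
    exact (centredMoments_thermal 1).isGaussianEquivalent (centredMoments_thermal 1)
      (isGaussianState_thermal 1)
  · rw [coherenceChannel_of_isEven hX.isEven,
      coherenceChannel_of_isEven (isEven_gaussianMeasure u v),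
      traceLogDiff_thermal_self (isDensity_thermal 1) (hasSum_nat_mul_entry_thermal 1)]

theorem charFn_thermal_add_thermal (a b : ℂ) (r : Fin 2 → ℝ) :
    charFn (a • thermal 0 + b • thermal 1) r =
      a * (Real.exp (-((r 0 ^ 2 + r 1 ^ 2) / 2)) : ℂ) +
      b * (Real.exp (-(3 * (r 0 ^ 2 + r 1 ^ 2) / 2)) : ℂ) := by
  rw [charFn_eq_of_diagonal fun m n h => by
    simp [entry_add, entry_smul, entry_thermal, h]]
  have h := ((hasSum_displacementEntry_mul_entry_thermal 0 r).mul_left a).add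
    ((hasSum_displacementEntry_mul_entry_thermal 1 r).mul_left b)
  convert! h.tsum_eq using 1
  · refine tsum_congr fun n => ?_
    rw [entry_add, entry_smul, entry_smul]
    ring
  · norm_num

/-- The coherent state `|1⟩` is mapped to `α |0⟩⟨0| + (1 - α) τ`, where `τ` is the thermal state of
mean photon number one and `α = 2/e`. A Gaussian `g` satisfies `|g(√2 r)| = |g(r)|²`, which fails
for a proper convex combination of the two Gaussians of different widths. -/
theorem not_isGaussianState_coherenceChannel :
    ¬ IsGaussianState (coherenceChannel (coherentMixture (Measure.dirac 1))) := by
  rintro ⟨-, d, V, hG⟩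
  set α : ℝ := 2 * Real.exp (-1) with hα
  have hα0 : 0 < α := by positivity
  have hα1 : α < 1 := by
    have h1 : 2 < Real.exp 1 := by linarith [Real.exp_one_gt_d9]
    have h2 : Real.exp (-1) * Real.exp 1 = 1 := by rw [← Real.exp_add]; simp
    nlinarith [Real.exp_pos (-1)]
  have hc : coherence (coherentMixture (Measure.dirac 1)) = (α : ℂ) := by
    have h1 : ((Real.exp (-1) : ℝ) : ℂ) =
        ((Real.exp (-1 / 2) : ℝ) : ℂ) * ((Real.exp (-1 / 2) : ℝ) : ℂ) := by
      rw [← Complex.ofReal_mul, ← Real.exp_add]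
      norm_num
    rw [coherence, entry_coherentMixture, entry_coherentMixture, integral_dirac, integral_dirac,
      hα, Complex.ofReal_mul, h1]
    simp only [coherent_apply, norm_one, one_pow, Complex.conj_ofReal,
      Nat.factorial_zero, Nat.factorial_one, Nat.cast_one, Real.sqrt_one, Complex.ofReal_one,
      div_one, mul_one]
    push_cast
    ring
  have hnorm : ∀ t : ℝ, α * Real.exp (-(t ^ 2 / 2)) + (1 - α) * Real.exp (-(3 * t ^ 2 / 2)) =
      Real.exp (-(V 1 1 * t ^ 2 / 2)) := fun t => by
    have h := congrArg norm (hG ![t, 0])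
    have h1 : charFn (coherenceChannel (coherentMixture (Measure.dirac 1))) ![t, 0] =
        ((α * Real.exp (-(t ^ 2 / 2)) + (1 - α) * Real.exp (-(3 * t ^ 2 / 2)) : ℝ) : ℂ) := by
      rw [coherenceChannel_eq, hc, (isDensity_coherentMixture _).tr_eq,
        charFn_thermal_add_thermal]
      simp
    have h0 : 0 ≤ 1 - α := by linarith
    rw [h1, Complex.norm_real, Real.norm_of_nonneg (by positivity), gaussianCharFn,
      Complex.norm_exp] at h
    rw [h]
    congr 1
    simp [Omega, dotProduct, Matrix.mulVec, Fin.sum_univ_two]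
    ring
  set y := Real.exp (-(1 / 2)) with hy
  have e1 := hnorm 1
  have e2 := hnorm (Real.sqrt 2)
  rw [Real.sq_sqrt zero_le_two] at e2
  have p1 : Real.exp (-(1 ^ 2 / 2)) = y := by rw [hy]; norm_num
  have p3 : Real.exp (-(3 * 1 ^ 2 / 2)) = y ^ 3 := by
    rw [hy, ← Real.exp_nat_mul]
    norm_num
  have p2 : Real.exp (-(2 / 2)) = y ^ 2 := by
    rw [hy, ← Real.exp_nat_mul]
    norm_num
  have p6 : Real.exp (-(3 * 2 / 2)) = y ^ 6 := by
    rw [hy, ← Real.exp_nat_mul]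
    norm_num
  have pV : Real.exp (-(V 1 1 * 2 / 2)) = Real.exp (-(V 1 1 * 1 ^ 2 / 2)) ^ 2 := by
    rw [← Real.exp_nat_mul]
    congr 1
    push_cast
    ring
  rw [p2, p6, pV, ← e1, p1, p3] at e2
  have h1 : α * (1 - α) * (y - y ^ 3) ^ 2 = 0 := by linear_combination e2
  have hy0 : 0 < y := Real.exp_pos _
  have hy1 : y < 1 := Real.exp_lt_one_iff.2 (by norm_num)
  have h2 : 0 < y - y ^ 3 := by
    have : y - y ^ 3 = y * (1 - y) * (1 + y) := by ring
    rw [this]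
    have := sub_pos.2 hy1
    positivity
  have h3 : 0 < 1 - α := sub_pos.2 hα1
  exact absurd h1 (by positivity)

end NGChan

end

theorem mainTheorem6 :
    (NGChan.nonnegDelta NGChan.symMixtures \ NGChan.gaussianChannels).Nonempty ∧
    ∀ l : ℝ, 0 < l →
      NGChan.phaseDiffusion l ∈
        NGChan.nonnegDelta NGChan.isoSymMixtures \ NGChan.gaussianChannels ∧
      (∀ ν : NNReal, NGChan.phaseDiffusion l (NGChan.thermal ν) = NGChan.thermal ν) ∧
      ∀ ρ ∈ NGChan.isoSymMixtures,
        NGChan.mean (NGChan.phaseDiffusion l ρ) = NGChan.mean ρ ∧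
        NGChan.cov (NGChan.phaseDiffusion l ρ) = NGChan.cov ρ ∧
        NGChan.IsDelta (NGChan.phaseDiffusion l) ρ 0 := by
  refine ⟨⟨NGChan.coherenceChannel,
    ⟨NGChan.isChannel_coherenceChannel, fun ρ hρ =>
      ⟨0, NGChan.isDelta_coherenceChannel hρ, le_rfl⟩⟩,
    fun h => NGChan.not_isGaussianState_coherenceChannel
      (h.2 _ (NGChan.isGaussianState_coherent 1))⟩, fun l hl => ⟨⟨?_, ?_⟩, ?_, ?_⟩⟩
  · exact ⟨NGChan.isChannel_phaseDiffusion l, fun ρ hρ =>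
      ⟨0, NGChan.isDelta_phaseDiffusion hρ l, le_rfl⟩⟩
  · exact fun h => NGChan.not_isGaussianState_phaseDiffusion hl
      (h.2 _ (NGChan.isGaussianState_coherent 1))
  · exact NGChan.phaseDiffusion_thermal l
  · intro ρ hρ
    obtain ⟨ν, h1, h2⟩ := NGChan.exists_centredMoments_of_mem_isoSymMixtures hρ l
    exact ⟨by rw [h1.mean_eq, h2.mean_eq], by rw [h1.cov_eq, h2.cov_eq],
      NGChan.isDelta_phaseDiffusion hρ l⟩
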